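/- Let $K$ be a field of characteristic zero. A graded Artinian $K$-algebra $A=\bigoplus_{i\ge 0}A_i$ has the strong Lefschetz property (SLP) with Lefschetz element $\ell\in A_1$ if every multiplication map $\times\ell^s:A_i\to A_{i+s}$ ($i\ge 0$, $s>0$) has full rank, i.e. is injective or surjective. For a positive integer $k$, $A$ has the $k$-SLP if there are $g_1,\dots,g_k\in A_1$ such that $A/(g_1,\dots,g_{i-1})$ has the SLP with Lefschetz element (the image of) $g_i$ for every $i=1,\dots,k$. For a sequence $h=(h_0,h_1,\dots,h_c)$ of non-negative integers put $h_i=0$ for $i<0$ and for $i>c$, let $(\Delta h)_i=\max\{h_i-h_{i-1},0\}$ for $i\ge 0$, and let $\Delta^s h$ be the result of applying $\Delta$ to $h$ $s$ times. An ideal of $K[x_1,\dots,x_n]$ is Borel-fixed if it is mapped onto itself by every substitution $x_j\mapsto\sum_{i\le j}g_{ij}x_i$ given by an invertible upper triangular matrix $(g_{ij})$ over $K$. **Lemma.** Let $k\ge 1$, let $R=K[x_1,\dots,x_n]$ with its standard grading, and let $I\subseteq R$ be a Borel-fixed ideal such that $A=R/I$ is Artinian and has the $k$-SLP. Let $h_A$,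 $(h_A)_d=\dim_K A_d$, be the Hilbert function of $A$. Suppose that for every $s$ with $0\le s\le k-1$ the sequence $h=\Delta^s h_A$ satisfies * (C1) for every $i\ge 0$ with $h_i<h_{i+1}$ there is at most one $j$ with $h_i<h_j<h_{i+1}$; * (C2) for every $i\ge 0$ with $h_i>h_{i+1}$ there is at most one $j$ with $h_i>h_j>h_{i+1}$; and that for every $s$ with $0\le s\le k-2$ the sequence $h=\Delta^s h_A$ satisfies * (C3) either there are two or more $i$ with $h_i=\max_j h_j$, or there is exactly one $i$ with $h_i=\max_j h_j$ and $h_{i-1}\ge h_{i+1}$. Then the tensor product $A\otimes_K K[y]/(y^2)$, graded by total degree with $\deg y=1$, has the $k$-SLP. -/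

import Mathlib

open scoped TensorProduct

namespace KSLP

/-! ### The strong Lefschetz property and the `k`-strong Lefschetz property

A graded `K`-algebra is a commutative `K`-algebra `A` together with the family
`𝒜 : ℕ → Submodule K A` of its graded components. -/

section Lefschetz

variable {K A : Type*} [Field K] [CommRing A] [Algebra K A]

/-- `(A, ℓ)` has the strong Lefschetz property: `ℓ` is a linear element and every multiplication
map `ℓ ^ s : A_i → A_{i+s}` with `i ≥ 0` and `s > 0` has full rank, that is, it is injective or
surjective. -/
def IsLefschetzElement (𝒜 : ℕ → Submodule K A) (ℓ : A) : Prop :=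
  ℓ ∈ 𝒜 1 ∧ ∀ i s : ℕ, 0 < s →
    Set.InjOn (fun a : A => ℓ ^ s * a) (𝒜 i : Set A) ∨
      Set.SurjOn (fun a : A => ℓ ^ s * a) (𝒜 i : Set A) (𝒜 (i + s) : Set A)

/-- The grading on `A / J` whose components are the images of the components of `A`. -/
def quotientGrading (𝒜 : ℕ → Submodule K A) (J : Ideal A) : ℕ → Submodule K (A ⧸ J) :=
  fun d => (𝒜 d).map (Ideal.Quotient.mkₐ K J).toLinearMap

/-- The graded algebra `A` has the `k`-strong Lefschetz property: there are linear elements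
`g_0, …, g_{k-1}` such that `(A / (g_0, …, g_{i-1}), g_i)` has the strong Lefschetz property for
all `i < k` (for `i = 0` the ideal is zero). -/
def HasKSLP (𝒜 : ℕ → Submodule K A) (k : ℕ) : Prop :=
  ∃ g : Fin k → A, (∀ i, g i ∈ 𝒜 1) ∧
    ∀ i : Fin k,
      IsLefschetzElement (quotientGrading 𝒜 (Ideal.span {a | ∃ j : Fin k, j < i ∧ g j = a}))
        (Ideal.Quotient.mk (Ideal.span {a | ∃ j : Fin k, j < i ∧ g j = a}) (g i))

/-- The Hilbert function `d ↦ dim_K A_d`. -/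
noncomputable def hilbertFunction (𝒜 : ℕ → Submodule K A) : ℕ → ℕ :=
  fun d => Module.finrank K (𝒜 d)

/-- The grading of the tensor product: `(A ⊗ B)_d` is the sum of the images of `A_i ⊗ B_j`
with `i + j = d`. -/
def tensorGrading {B : Type*} [CommRing B] [Algebra K B]
    (𝒜 : ℕ → Submodule K A) (ℬ : ℕ → Submodule K B) : ℕ → Submodule K (A ⊗[K] B) :=
  fun d => ⨆ (p : ℕ × ℕ) (_ : p.1 + p.2 = d), Submodule.map₂ (TensorProduct.mk K A B) (𝒜 p.1) (ℬ p.2)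

end Lefschetz

/-! ### Conditions on Hilbert functions

An `h`-vector `(h_0, …, h_c)` is the function `ℕ → ℕ` extended by `0` in degrees `> c`. -/

/-- `h_{i-1}`, where `h_{-1} = 0`. -/
def prev (h : ℕ → ℕ) : ℕ → ℕ
  | 0 => 0
  | i + 1 => h i

/-- `(Δh)_i = max (h_i - h_{i-1}) 0`, written with the truncated subtraction of `ℕ`. -/
def diff (h : ℕ → ℕ) : ℕ → ℕ :=
  fun i => h i - prev h i

/-- For any `h_i < h_{i+1}` there is at most one `j` with `h_i < h_j < h_{i+1}`. -/
def CondC1 (h : ℕ → ℕ) : Prop :=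
  ∀ i, h i < h (i + 1) → {j | h i < h j ∧ h j < h (i + 1)}.Subsingleton

/-- For any `h_i > h_{i+1}` there is at most one `j` with `h_i > h_j > h_{i+1}`. -/
def CondC2 (h : ℕ → ℕ) : Prop :=
  ∀ i, h (i + 1) < h i → {j | h (i + 1) < h j ∧ h j < h i}.Subsingleton

/-- `h_i = max_j h_j`. -/
def IsMaxAt (h : ℕ → ℕ) (i : ℕ) : Prop :=
  ∀ j, h j ≤ h i

/-- The maximum of `h` is attained at two or more places, or it is attained at exactly one
place `i` and `h_{i-1} ≥ h_{i+1}`. -/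
def CondC3 (h : ℕ → ℕ) : Prop :=
  (∃ i j, i ≠ j ∧ IsMaxAt h i ∧ IsMaxAt h j) ∨
    ∃ i, IsMaxAt h i ∧ (∀ j, IsMaxAt h j → j = i) ∧ h (i + 1) ≤ prev h i

/-! ### Quotients of polynomial rings -/

/-- The linear substitution `x_j ↦ ∑_i g_{ij} x_i` on `K[x_1, …, x_n]`. -/
noncomputable def linearSubst {K : Type*} [Field K] {n : ℕ} (g : GL (Fin n) K) :
    MvPolynomial (Fin n) K →ₐ[K] MvPolynomial (Fin n) K :=
  MvPolynomial.aeval fun j => ∑ i, MvPolynomial.C (g.val i j) * MvPolynomial.X i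

/-- The ideal `I` is Borel-fixed: `g • I = I` for every invertible upper triangular matrix `g`
(`g_{ij} = 0` for `j < i`, so that `x_j` is sent to a combination of `x_1, …, x_j`). -/
def IsBorelFixed {K : Type*} [Field K] {n : ℕ} (I : Ideal (MvPolynomial (Fin n) K)) : Prop :=
  ∀ g : GL (Fin n) K, (∀ i j : Fin n, j < i → g.val i j = 0) → I.map (linearSubst g) = I

/-- The standard grading of `K[x_1, …, x_n] / I`. -/
noncomputable def polyQuotGrading {K : Type*} [Field K] {n : ℕ}
    (I : Ideal (MvPolynomial (Fin n) K)) : ℕ → Submodule K (MvPolynomial (Fin n) K ⧸ I) :=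
  quotientGrading (MvPolynomial.homogeneousSubmodule (Fin n) K) I

/-- The algebra `K[y] / (y ^ 2)`. -/
abbrev TruncY (K : Type*) [Field K] : Type _ :=
  Polynomial K ⧸ Ideal.span {(Polynomial.X ^ 2 : Polynomial K)}

/-- The standard grading of `K[y] / (y ^ 2)`, with `y` of degree `1`: the component of degree `d`
is the image of the line spanned by `y ^ d`. -/
noncomputable def truncYGrading (K : Type*) [Field K] : ℕ → Submodule K (TruncY K) :=
  quotientGrading (fun d => Submodule.span K {(Polynomial.X ^ d : Polynomial K)})
    (Ideal.span {(Polynomial.X ^ 2 : Polynomial K)})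

end KSLP

/-! Write `R` for the polynomial ring, `x` for its last variable and `h` for the Hilbert function of
`R/I`. The tensor product is `R[y]/(I, y²)`, and its `k`-SLP is shown by induction on `k`.

Borel-fixedness lets `x` play the role of a general linear form. Full rank is an open condition, so
the first form `g` of a Lefschetz sequence may be replaced by `g + t x` for all but finitely many
`t`. Such a form has nonzero `x`-coefficient, and a triangular substitution, which preserves `I`,
carries `x` to it. Hence `x` is a Lefschetz element of `R/I` and `R/(I, x)` has the `(k-1)`-SLP
(`IsStable.slpMod_last`).

Next, `x + y` is a Lefschetz element of `R[y]/(I, y²)` (`SLPMod.add_squareZero`). Since `y² = 0`, a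
power of `x + y` acts on `p + y q` through powers of `x` between four degrees. An `h` without
valleys that satisfies (C1) and (C2) always makes two of these powers both injective or both
surjective in a way that suffices.

Dividing by `x + y` amounts to setting `y = -x`, which leaves `R/(I, x²)`. Let `R'` be the ring
without `x` and `I' = I ∩ R'`. Then `R'/I'` is `R/(I, x)`, with Hilbert function `Δh`, so by
induction `R'[x]/(I', x²)` has the `(k-1)`-SLP. The ring `R/(I, x²)` is a quotient of it, and by
(C3) in each degree the quotient is zero or unchanged (`IsStable.eq_or_forall_mem`). Killing whole
components keeps the property (`KSLPMod.of_le`). -/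

namespace KSLP

/-! ### Lefschetz properties of `A / J`, expressed inside `A` -/

section Modulo

variable {K A : Type*} [Field K] [CommRing A] [Algebra K A]

/-- Multiplication by `g ^ s` on `A / J` is injective in degree `i`. -/
def InjAt (𝒜 : ℕ → Submodule K A) (J : Ideal A) (g : A) (i s : ℕ) : Prop :=
  ∀ a ∈ 𝒜 i, g ^ s * a ∈ J → a ∈ J

/-- Multiplication by `g ^ s` on `A / J` maps degree `i` onto degree `i + s`. -/
def SurjAt (𝒜 : ℕ → Submodule K A) (J : Ideal A) (g : A) (i s : ℕ) : Prop :=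
  ∀ b ∈ 𝒜 (i + s), ∃ a ∈ 𝒜 i, b - g ^ s * a ∈ J

/-- The image of `g` is a Lefschetz element of `A / J`. -/
def SLPMod (𝒜 : ℕ → Submodule K A) (J : Ideal A) (g : A) : Prop :=
  ∀ i s : ℕ, 0 < s → InjAt 𝒜 J g i s ∨ SurjAt 𝒜 J g i s

/-- The quotient `A / J` has the `k`-strong Lefschetz property, stated recursively in `A`. -/
def KSLPMod (𝒜 : ℕ → Submodule K A) : ℕ → Ideal A → Prop
  | 0, _ => True
  | k + 1, J => ∃ g ∈ 𝒜 1, SLPMod 𝒜 J g ∧ KSLPMod 𝒜 k (J ⊔ Ideal.span {g})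

theorem isLefschetzElement_quotientGrading_iff {𝒜 : ℕ → Submodule K A} {J : Ideal A} {g : A}
    (hg : g ∈ 𝒜 1) :
    IsLefschetzElement (quotientGrading 𝒜 J) (Ideal.Quotient.mk J g) ↔ SLPMod 𝒜 J g := by
  have h1 : Ideal.Quotient.mk J g ∈ quotientGrading 𝒜 J 1 := ⟨g, hg, rfl⟩
  simp only [IsLefschetzElement, h1, true_and, SLPMod]
  refine forall_congr' fun i => forall_congr' fun s => imp_congr_right fun _ => or_congr ?_ ?_
  · constructor
    · intro h a ha hga
      have := h (x₁ := Ideal.Quotient.mk J a) ⟨a, ha, rfl⟩ (x₂ := 0) (zero_mem _) (by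
        simp only [mul_zero]
        exact Ideal.Quotient.eq_zero_iff_mem.2 hga)
      exact Ideal.Quotient.eq_zero_iff_mem.1 this
    · rintro h _ ⟨a, ha, rfl⟩ _ ⟨b, hb, rfl⟩ hab
      refine Ideal.Quotient.eq.2 (h _ (sub_mem ha hb) ?_)
      rw [mul_sub]
      exact Ideal.Quotient.eq.1 (by simpa using hab)
  · constructor
    · intro h b hb
      obtain ⟨_, ⟨a, ha, rfl⟩, hab⟩ := h (Submodule.mem_map_of_mem hb)
      exact ⟨a, ha, Ideal.Quotient.eq.1 (by simpa using hab.symm)⟩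
    · rintro h _ ⟨b, hb, rfl⟩
      obtain ⟨a, ha, hab⟩ := h b hb
      exact ⟨Ideal.Quotient.mk J a, ⟨a, ha, rfl⟩, by simpa using (Ideal.Quotient.eq.2 hab).symm⟩

theorem kslpMod_iff_exists {𝒜 : ℕ → Submodule K A} (k : ℕ) (J : Ideal A) :
    KSLPMod 𝒜 k J ↔ ∃ g : Fin k → A, (∀ i, g i ∈ 𝒜 1) ∧
      ∀ i : Fin k, SLPMod 𝒜 (J ⊔ Ideal.span {a | ∃ j : Fin k, j < i ∧ g j = a}) (g i) := by
  induction k generalizing J with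
  | zero => exact ⟨fun _ => ⟨Fin.elim0, fun i => i.elim0, fun i => i.elim0⟩, fun _ => trivial⟩
  | succ k ih =>
    have key : ∀ (a : A) (g : Fin k → A) (i : Fin k),
        J ⊔ Ideal.span {b | ∃ j : Fin (k + 1), j < i.succ ∧ (Fin.cons a g : Fin (k + 1) → A) j = b}
          = J ⊔ Ideal.span {a} ⊔ Ideal.span {b | ∃ j : Fin k, j < i ∧ g j = b} := by
      intro a g i
      rw [sup_assoc, ← Ideal.span_union]
      congr 2
      ext b
      simp [Fin.exists_fin_succ, eq_comm]
    have key0 : ∀ g : Fin (k + 1) → A,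
        J ⊔ Ideal.span {b | ∃ j : Fin (k + 1), j < 0 ∧ g j = b} = J := by
      intro g; simp
    simp only [KSLPMod, ih]
    constructor
    · rintro ⟨a, ha, hs, g, hg, h⟩
      refine ⟨Fin.cons a g, fun i => ?_, fun i => ?_⟩
      · refine Fin.cases ?_ (fun i => ?_) i
        · simpa using ha
        · simpa using hg i
      · refine Fin.cases ?_ (fun i => ?_) i
        · rw [key0]; simpa using hs
        · rw [key]; simpa using h i
    · rintro ⟨g, hg, h⟩
      refine ⟨g 0, hg 0, by simpa only [key0] using h 0, Fin.tail g, fun i => hg _, fun i => ?_⟩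
      rw [← key, Fin.cons_self_tail]
      exact h i.succ

theorem hasKSLP_iff_kslpMod {𝒜 : ℕ → Submodule K A} (k : ℕ) :
    HasKSLP 𝒜 k ↔ KSLPMod 𝒜 k ⊥ := by
  rw [kslpMod_iff_exists, HasKSLP]
  refine exists_congr fun g => and_congr_right fun hg => forall_congr' fun i => ?_
  rw [isLefschetzElement_quotientGrading_iff (hg i), bot_sup_eq]

/-! ### Transport along graded surjections -/

section Transport

variable {B : Type*} [CommRing B] [Algebra K B]
variable {𝒜 : ℕ → Submodule K A} {ℬ : ℕ → Submodule K B}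

theorem slpMod_comap_iff (f : A →ₐ[K] B) (hf : ∀ i, (𝒜 i).map f.toLinearMap = ℬ i)
    (J : Ideal B) (g : A) : SLPMod 𝒜 (J.comap f) g ↔ SLPMod ℬ J (f g) := by
  refine forall_congr' fun i => forall_congr' fun s => imp_congr_right fun _ => or_congr ?_ ?_
  · simp only [InjAt, ← hf, Submodule.mem_map]
    constructor
    · rintro h _ ⟨a, ha, rfl⟩ hga
      exact h a ha (by simpa using hga)
    · intro h a ha hga
      exact h (f a) ⟨a, ha, rfl⟩ (by simpa using hga)
  · simp only [SurjAt, ← hf, Submodule.mem_map]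
    constructor
    · rintro h _ ⟨b, hb, rfl⟩
      obtain ⟨a, ha, hab⟩ := h b hb
      exact ⟨f a, ⟨a, ha, rfl⟩, by simpa using hab⟩
    · intro h b hb
      obtain ⟨_, ⟨a, ha, rfl⟩, hab⟩ := h (f b) ⟨b, hb, rfl⟩
      exact ⟨a, ha, by simpa using hab⟩

theorem comap_sup_span_singleton (f : A →ₐ[K] B) (hs : Function.Surjective f) (J : Ideal B)
    (g : A) : (J ⊔ Ideal.span {f g}).comap f = J.comap f ⊔ Ideal.span {g} := by
  have h : J ⊔ Ideal.span {f g} = (J.comap f ⊔ Ideal.span {g}).map f := by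
    rw [Ideal.map_sup, Ideal.map_comap_of_surjective f hs, Ideal.map_span, Set.image_singleton]
  rw [h, Ideal.comap_map_of_surjective f hs]
  exact sup_eq_left.2 ((Ideal.comap_mono bot_le).trans le_sup_left)

/-- `A / f⁻¹(J)` and `B / J` are the same graded algebra. All later changes of ring go through this
lemma. -/
theorem kslpMod_comap_iff (f : A →ₐ[K] B) (hs : Function.Surjective f)
    (hf : ∀ i, (𝒜 i).map f.toLinearMap = ℬ i) (k : ℕ) (J : Ideal B) :
    KSLPMod 𝒜 k (J.comap f) ↔ KSLPMod ℬ k J := by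
  induction k generalizing J with
  | zero => exact Iff.rfl
  | succ k ih =>
    simp only [KSLPMod]
    constructor
    · rintro ⟨g, hg, h1, h2⟩
      refine ⟨f g, hf 1 ▸ ⟨g, hg, rfl⟩, (slpMod_comap_iff f hf J g).1 h1, (ih _).1 ?_⟩
      rwa [comap_sup_span_singleton f hs]
    · rintro ⟨g', hg', h1, h2⟩
      rw [← hf 1] at hg'
      obtain ⟨g, hg, rfl⟩ := hg'
      refine ⟨g, hg, (slpMod_comap_iff f hf J g).2 h1, ?_⟩
      rw [← comap_sup_span_singleton f hs]
      exact (ih _).2 h2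

end Transport

/-! ### Full rank in terms of dimensions -/

section Dimension

/-- The degree `d` part of an ideal. -/
def degPart (𝒜 : ℕ → Submodule K A) (J : Ideal A) (d : ℕ) : Submodule K A :=
  𝒜 d ⊓ J.restrictScalars K

theorem finrank_map_add_finrank_inf_ker {V W : Type*} [AddCommGroup V] [Module K V]
    [AddCommGroup W] [Module K W] (f : V →ₗ[K] W) (p : Submodule K V) [FiniteDimensional K p] :
    Module.finrank K (p.map f) + Module.finrank K (p ⊓ LinearMap.ker f : Submodule K V) =
      Module.finrank K p := by
  rw [← LinearMap.finrank_range_add_finrank_ker (f.domRestrict p), LinearMap.range_domRestrict,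
    LinearMap.ker_domRestrict, ← Submodule.finrank_map_subtype_eq p, Submodule.map_comap_subtype]


variable (𝒜 : ℕ → Submodule K A)
variable (J : Ideal A) (g : A) (i s : ℕ)

theorem finiteDimensional_degPart (hfin : ∀ d, FiniteDimensional K (𝒜 d)) (d : ℕ) :
    FiniteDimensional K (degPart 𝒜 J d) :=
  have := hfin d
  Submodule.finiteDimensional_of_le (inf_le_left : degPart 𝒜 J d ≤ 𝒜 d)

theorem ker_quotient_mk :
    LinearMap.ker (Ideal.Quotient.mkₐ K J).toLinearMap = J.restrictScalars K := by
  ext a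
  simp [Ideal.Quotient.eq_zero_iff_mem]

theorem hilbertFunction_add_finrank_degPart (hfin : ∀ d, FiniteDimensional K (𝒜 d)) (d : ℕ) :
    hilbertFunction (quotientGrading 𝒜 J) d + Module.finrank K (degPart 𝒜 J d) =
      Module.finrank K (𝒜 d) := by
  have := hfin d
  rw [← finrank_map_add_finrank_inf_ker (Ideal.Quotient.mkₐ K J).toLinearMap (𝒜 d),
    ker_quotient_mk]
  rfl

theorem mem_of_hilbertFunction_eq_zero {𝒜 : ℕ → Submodule K A} {J : Ideal A}
    (hfin : ∀ d, FiniteDimensional K (𝒜 d)) {d : ℕ}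
    (hd : hilbertFunction (quotientGrading 𝒜 J) d = 0) {a : A} (ha : a ∈ 𝒜 d) : a ∈ J := by
  have := hfin d
  have h : (𝒜 d).map (Ideal.Quotient.mkₐ K J).toLinearMap = ⊥ := Submodule.finrank_eq_zero.1 hd
  exact Ideal.Quotient.eq_zero_iff_mem.1
    ((Submodule.mem_bot K).1 (h ▸ Submodule.mem_map_of_mem ha))

theorem hilbertFunction_comap {B : Type*} [CommRing B] [Algebra K B] {𝒜 : ℕ → Submodule K A}
    {ℬ : ℕ → Submodule K B} (f : A →ₐ[K] B) (hf : ∀ i, (𝒜 i).map f.toLinearMap = ℬ i)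
    (J : Ideal B) :
    hilbertFunction (quotientGrading 𝒜 (J.comap f)) = hilbertFunction (quotientGrading ℬ J) := by
  funext d
  let φ : A ⧸ J.comap f →ₐ[K] B ⧸ J := Ideal.quotientMapₐ J f le_rfl
  have hφ : Function.Injective φ.toLinearMap := Ideal.quotientMap_injective (f := f.toRingHom)
  have h : (quotientGrading 𝒜 (J.comap f) d).map φ.toLinearMap = quotientGrading ℬ J d := by
    rw [quotientGrading, quotientGrading, ← hf, ← Submodule.map_comp, ← Submodule.map_comp]
    rfl
  rw [hilbertFunction, hilbertFunction, ← h]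
  exact (Submodule.equivMapOfInjective φ.toLinearMap hφ _).finrank_eq

/-- The elements of degree `i` that `g ^ s` multiplies into `J`. -/
def colonPart : Submodule K A :=
  𝒜 i ⊓ (J.restrictScalars K).comap (LinearMap.mulLeft K (g ^ s))

/-- The sum of the degree `i + s` part of `J` and the multiples of `g ^ s` by degree `i`. -/
def imagePart : Submodule K A :=
  degPart 𝒜 J (i + s) ⊔ (𝒜 i).map (LinearMap.mulLeft K (g ^ s))

theorem degPart_le_colonPart : degPart 𝒜 J i ≤ colonPart 𝒜 J g i s :=
  fun _ ha => ⟨ha.1, J.mul_mem_left _ ha.2⟩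

theorem injAt_iff_finrank (hfin : ∀ d, FiniteDimensional K (𝒜 d)) :
    InjAt 𝒜 J g i s ↔
      Module.finrank K (colonPart 𝒜 J g i s) ≤ Module.finrank K (degPart 𝒜 J i) := by
  have := hfin i
  constructor
  · intro h
    have := finiteDimensional_degPart 𝒜 J hfin i
    exact Submodule.finrank_mono fun a ha => ⟨ha.1, h a ha.1 ha.2⟩
  · intro h a ha hga
    have : FiniteDimensional K (colonPart 𝒜 J g i s) :=
      Submodule.finiteDimensional_of_le (inf_le_left : _ ≤ 𝒜 i)
    have heq := Submodule.eq_of_le_of_finrank_le (degPart_le_colonPart 𝒜 J g i s) h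
    have : a ∈ colonPart 𝒜 J g i s := ⟨ha, hga⟩
    exact (heq ▸ this : a ∈ degPart 𝒜 J i).2

variable [SetLike.GradedMonoid 𝒜]

theorem pow_mul_mem {g a : A} (hg : g ∈ 𝒜 1) (s : ℕ) {i : ℕ} (ha : a ∈ 𝒜 i) :
    g ^ s * a ∈ 𝒜 (i + s) := by
  have := SetLike.mul_mem_graded (SetLike.pow_mem_graded s hg) ha
  rwa [smul_eq_mul, mul_one, add_comm] at this

theorem imagePart_le {g : A} (hg : g ∈ 𝒜 1) : imagePart 𝒜 J g i s ≤ 𝒜 (i + s) := by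
  refine sup_le inf_le_left ?_
  rintro _ ⟨a, ha, rfl⟩
  exact pow_mul_mem 𝒜 hg s ha

/-- Rank-nullity for `g ^ s : A_i → (A / J)_{i+s}`: the kernel is `colonPart`, and `imagePart` is
the preimage of the image in degree `i + s`. -/
theorem finrank_colonPart_add_finrank_imagePart (hfin : ∀ d, FiniteDimensional K (𝒜 d)) {g : A}
    (hg : g ∈ 𝒜 1) :
    Module.finrank K (colonPart 𝒜 J g i s) + Module.finrank K (imagePart 𝒜 J g i s) =
      Module.finrank K (𝒜 i) + Module.finrank K (degPart 𝒜 J (i + s)) := by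
  have := hfin i
  have := hfin (i + s)
  have := Submodule.finiteDimensional_of_le (imagePart_le 𝒜 J i s hg)
  let π := (Ideal.Quotient.mkₐ K J).toLinearMap
  have h1 := finrank_map_add_finrank_inf_ker (π ∘ₗ LinearMap.mulLeft K (g ^ s)) (𝒜 i)
  have h2 := finrank_map_add_finrank_inf_ker π (imagePart 𝒜 J g i s)
  have h3 : 𝒜 i ⊓ LinearMap.ker (π ∘ₗ LinearMap.mulLeft K (g ^ s)) = colonPart 𝒜 J g i s := by
    rw [LinearMap.ker_comp, ker_quotient_mk, colonPart]
  have h4 : imagePart 𝒜 J g i s ⊓ LinearMap.ker π = degPart 𝒜 J (i + s) := by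
    rw [ker_quotient_mk]
    exact le_antisymm (fun a ha => ⟨imagePart_le 𝒜 J i s hg ha.1, ha.2⟩)
      (le_inf le_sup_left inf_le_right)
  have h5 : (imagePart 𝒜 J g i s).map π = (𝒜 i).map (π ∘ₗ LinearMap.mulLeft K (g ^ s)) := by
    rw [imagePart, Submodule.map_sup, ← Submodule.map_comp]
    refine sup_eq_right.2 ?_
    rintro _ ⟨a, ha, rfl⟩
    rw [show π a = 0 from Ideal.Quotient.eq_zero_iff_mem.2 ha.2]
    exact zero_mem _
  rw [h3] at h1
  rw [h4, h5] at h2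
  omega

theorem surjAt_iff_finrank (hfin : ∀ d, FiniteDimensional K (𝒜 d)) {g : A} (hg : g ∈ 𝒜 1) :
    SurjAt 𝒜 J g i s ↔
      Module.finrank K (𝒜 (i + s)) ≤ Module.finrank K (imagePart 𝒜 J g i s) := by
  have := hfin (i + s)
  constructor
  · intro h
    have := Submodule.finiteDimensional_of_le (imagePart_le 𝒜 J i s hg)
    refine Submodule.finrank_mono fun b hb => ?_
    obtain ⟨a, ha, hab⟩ := h b hb
    have hga := pow_mul_mem 𝒜 hg s ha
    rw [← sub_add_cancel b (g ^ s * a)]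
    exact add_mem (Submodule.mem_sup_left ⟨sub_mem hb hga, hab⟩)
      (Submodule.mem_sup_right ⟨a, ha, rfl⟩)
  · intro h b hb
    rw [← Submodule.eq_of_le_of_finrank_le (imagePart_le 𝒜 J i s hg) h] at hb
    obtain ⟨c, hc, _, ⟨a, ha, rfl⟩, rfl⟩ := Submodule.mem_sup.1 hb
    exact ⟨a, ha, by simpa using hc.2⟩

variable {𝒜 J g i s}

theorem InjAt.hilbertFunction_le (hfin : ∀ d, FiniteDimensional K (𝒜 d)) (hg : g ∈ 𝒜 1)
    (h : InjAt 𝒜 J g i s) :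
    hilbertFunction (quotientGrading 𝒜 J) i ≤ hilbertFunction (quotientGrading 𝒜 J) (i + s) := by
  have := hfin (i + s)
  have h1 := (injAt_iff_finrank 𝒜 J g i s hfin).1 h
  have h2 := finrank_colonPart_add_finrank_imagePart 𝒜 J i s hfin hg
  have h3 := hilbertFunction_add_finrank_degPart 𝒜 J hfin i
  have h4 := hilbertFunction_add_finrank_degPart 𝒜 J hfin (i + s)
  have h5 := Submodule.finrank_mono (imagePart_le 𝒜 J i s hg)
  omega

theorem SurjAt.hilbertFunction_le (hfin : ∀ d, FiniteDimensional K (𝒜 d)) (hg : g ∈ 𝒜 1)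
    (h : SurjAt 𝒜 J g i s) :
    hilbertFunction (quotientGrading 𝒜 J) (i + s) ≤ hilbertFunction (quotientGrading 𝒜 J) i := by
  have := hfin i
  have : FiniteDimensional K (colonPart 𝒜 J g i s) :=
    Submodule.finiteDimensional_of_le (inf_le_left : _ ≤ 𝒜 i)
  have h1 := (surjAt_iff_finrank 𝒜 J i s hfin hg).1 h
  have h2 := finrank_colonPart_add_finrank_imagePart 𝒜 J i s hfin hg
  have h3 := hilbertFunction_add_finrank_degPart 𝒜 J hfin i
  have h4 := hilbertFunction_add_finrank_degPart 𝒜 J hfin (i + s)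
  have h5 := Submodule.finrank_mono (degPart_le_colonPart 𝒜 J g i s)
  omega

/-- A surjection onto a space of at least the same finite dimension is bijective, so the Hilbert
function decides which half of "full rank" holds. -/
theorem SLPMod.injAt (h : SLPMod 𝒜 J g) (hfin : ∀ d, FiniteDimensional K (𝒜 d)) (hg : g ∈ 𝒜 1)
    (hle : hilbertFunction (quotientGrading 𝒜 J) i ≤
      hilbertFunction (quotientGrading 𝒜 J) (i + s)) : InjAt 𝒜 J g i s := by
  rcases Nat.eq_zero_or_pos s with rfl | hs
  · intro a _ ha
    simpa using ha
  rcases h i s hs with h | h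
  · exact h
  have h1 := (surjAt_iff_finrank 𝒜 J i s hfin hg).1 h
  have h2 := finrank_colonPart_add_finrank_imagePart 𝒜 J i s hfin hg
  have h3 := hilbertFunction_add_finrank_degPart 𝒜 J hfin i
  have h4 := hilbertFunction_add_finrank_degPart 𝒜 J hfin (i + s)
  rw [injAt_iff_finrank 𝒜 J g i s hfin]
  omega

theorem SLPMod.surjAt (h : SLPMod 𝒜 J g) (hfin : ∀ d, FiniteDimensional K (𝒜 d)) (hg : g ∈ 𝒜 1)
    (hle : hilbertFunction (quotientGrading 𝒜 J) (i + s) ≤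
      hilbertFunction (quotientGrading 𝒜 J) i) : SurjAt 𝒜 J g i s := by
  rcases Nat.eq_zero_or_pos s with rfl | hs
  · intro a ha
    exact ⟨a, ha, by simp⟩
  rcases h i s hs with h | h
  swap
  · exact h
  have h1 := (injAt_iff_finrank 𝒜 J g i s hfin).1 h
  have h2 := finrank_colonPart_add_finrank_imagePart 𝒜 J i s hfin hg
  have h3 := hilbertFunction_add_finrank_degPart 𝒜 J hfin i
  have h4 := hilbertFunction_add_finrank_degPart 𝒜 J hfin (i + s)
  rw [surjAt_iff_finrank 𝒜 J i s hfin hg]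
  omega

/-- The Hilbert function of an algebra with the strong Lefschetz property has no valleys. -/
theorem SLPMod.not_valley (h : SLPMod 𝒜 J g) (hfin : ∀ d, FiniteDimensional K (𝒜 d))
    (hg : g ∈ 𝒜 1) {a b c : ℕ} (hab : a ≤ b) (hbc : b ≤ c)
    (h1 : hilbertFunction (quotientGrading 𝒜 J) b < hilbertFunction (quotientGrading 𝒜 J) a)
    (h2 : hilbertFunction (quotientGrading 𝒜 J) b < hilbertFunction (quotientGrading 𝒜 J) c) :
    False := by
  obtain ⟨s, rfl⟩ := Nat.exists_eq_add_of_le hab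
  obtain ⟨t, rfl⟩ := Nat.exists_eq_add_of_le hbc
  -- The map from degree `a` to degree `c` factors through degree `b`. If it is injective, so is its
  -- first factor; if it is surjective, so is its second.
  rcases le_total (hilbertFunction (quotientGrading 𝒜 J) a)
    (hilbertFunction (quotientGrading 𝒜 J) (a + s + t)) with hle | hle
  · rw [add_assoc] at hle
    have hi := h.injAt hfin hg hle
    have : InjAt 𝒜 J g a s := fun x hx hgx => hi x hx (by
      rw [pow_add, mul_comm (g ^ s), mul_assoc]
      exact J.mul_mem_left _ hgx)
    exact absurd (this.hilbertFunction_le hfin hg) (by omega)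
  · rw [add_assoc] at hle
    have hi := h.surjAt hfin hg hle
    have : SurjAt 𝒜 J g (a + s) t := fun x hx => by
      obtain ⟨y, hy, hxy⟩ := hi x (by rwa [← add_assoc])
      exact ⟨g ^ s * y, pow_mul_mem 𝒜 hg s hy, by rwa [← mul_assoc, ← pow_add, add_comm t]⟩
    exact absurd (this.hilbertFunction_le hfin hg) (by omega)

end Dimension

end Modulo

/-! ### Homogeneous ideals and quotients by a linear form -/

section Homogeneous

variable {K A : Type*} [Field K] [CommRing A] [Algebra K A]
variable {𝒜 : ℕ → Submodule K A} [GradedAlgebra 𝒜] {J : Ideal A}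

theorem mem_of_mem_sup_span_singleton {u f : A} {s d : ℕ} (hJ : J.IsHomogeneous 𝒜)
    (hu : u ∈ 𝒜 s) (hf : f ∈ 𝒜 d) (hd : d < s) (h : f ∈ J ⊔ Ideal.span {u}) : f ∈ J := by
  obtain ⟨a, ha, _, hb, rfl⟩ := Submodule.mem_sup.1 h
  obtain ⟨b, rfl⟩ := Ideal.mem_span_singleton'.1 hb
  rw [← DirectSum.decompose_of_mem_same 𝒜 hf, DirectSum.decompose_add, DirectSum.add_apply,
    Submodule.coe_add, mul_comm b,
    DirectSum.coe_decompose_mul_of_left_mem_of_not_le 𝒜 hu (by omega), add_zero]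
  exact hJ d ha

theorem exists_eq_add_of_mem_sup_span_singleton {u f : A} {s i : ℕ} (hJ : J.IsHomogeneous 𝒜)
    (hu : u ∈ 𝒜 s) (hf : f ∈ 𝒜 (i + s)) (h : f ∈ J ⊔ Ideal.span {u}) :
    ∃ a ∈ degPart 𝒜 J (i + s), ∃ b ∈ 𝒜 i, f = a + u * b := by
  obtain ⟨a, ha, _, hb, rfl⟩ := Submodule.mem_sup.1 h
  obtain ⟨b, rfl⟩ := Ideal.mem_span_singleton'.1 hb
  refine ⟨DirectSum.decompose 𝒜 a (i + s), ⟨SetLike.coe_mem _, hJ _ ha⟩,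
    DirectSum.decompose 𝒜 b i, SetLike.coe_mem _, ?_⟩
  conv_lhs => rw [← DirectSum.decompose_of_mem_same 𝒜 hf]
  rw [DirectSum.decompose_add, DirectSum.add_apply,
    Submodule.coe_add, mul_comm b,
    DirectSum.coe_decompose_mul_of_left_mem_of_le 𝒜 hu (by omega), Nat.add_sub_cancel]

theorem isHomogeneous_sup_span_singleton {u : A} {s : ℕ} (hJ : J.IsHomogeneous 𝒜)
    (hu : u ∈ 𝒜 s) : (J ⊔ Ideal.span {u}).IsHomogeneous 𝒜 :=
  hJ.sup (Ideal.homogeneous_span 𝒜 _ (by rintro x rfl; exact ⟨s, hu⟩))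

theorem imagePart_eq_degPart {g : A} {i s : ℕ} (hJ : J.IsHomogeneous 𝒜) (hg : g ∈ 𝒜 1) :
    imagePart 𝒜 J g i s = degPart 𝒜 (J ⊔ Ideal.span {g ^ s}) (i + s) := by
  refine le_antisymm (sup_le (fun a ha => ⟨ha.1, Ideal.mem_sup_left ha.2⟩) ?_) fun f hf => ?_
  · rintro _ ⟨a, ha, rfl⟩
    exact ⟨pow_mul_mem 𝒜 hg s ha, Ideal.mem_sup_right
      (Ideal.mul_mem_right _ _ (Ideal.mem_span_singleton_self _))⟩
  · have hgs : g ^ s ∈ 𝒜 s := by simpa using SetLike.pow_mem_graded s hg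
    obtain ⟨a, ha, b, hb, rfl⟩ := exists_eq_add_of_mem_sup_span_singleton hJ hgs hf.1 hf.2
    exact add_mem (Submodule.mem_sup_left ha) (Submodule.mem_sup_right ⟨b, hb, rfl⟩)

/-- Killing whole components preserves the `k`-strong Lefschetz property. -/
theorem KSLPMod.of_le (k : ℕ) {J₁ J₂ : Ideal A} (h₁ : J₁.IsHomogeneous 𝒜)
    (h₂ : J₂.IsHomogeneous 𝒜) (hle : J₁ ≤ J₂)
    (h : ∀ d, (∀ a ∈ 𝒜 d, a ∈ J₂) ∨ ∀ a ∈ 𝒜 d, a ∈ J₂ → a ∈ J₁)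
    (hk : KSLPMod 𝒜 k J₁) : KSLPMod 𝒜 k J₂ := by
  induction k generalizing J₁ J₂ with
  | zero => trivial
  | succ k ih =>
    obtain ⟨g, hg, hs, hk⟩ := hk
    refine ⟨g, hg, fun i s hs0 => ?_, ih (isHomogeneous_sup_span_singleton h₁ hg)
      (isHomogeneous_sup_span_singleton h₂ hg) (sup_le_sup_right hle _) (fun d => ?_) hk⟩
    -- Only the target degree matters: it vanishes modulo `J₂`, or there `J₁` and `J₂` agree.
    · rcases h (i + s) with h' | h'
      · exact Or.inr fun b hb => ⟨0, zero_mem _, by simpa using h' b hb⟩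
      · refine (hs i s hs0).imp (fun hi a ha hga => ?_) fun hi b hb => ?_
        · exact hle (hi a ha (h' _ (pow_mul_mem 𝒜 hg s ha) hga))
        · obtain ⟨a, ha, hab⟩ := hi b hb
          exact ⟨a, ha, hle hab⟩
    -- In degree `d`, adding `g` contributes `g · A_{d-1}` to both ideals, whatever they are in
    -- degree `d - 1`.
    · refine (h d).imp (fun h' a ha => Ideal.mem_sup_left (h' a ha)) fun h' a ha haJ => ?_
      rcases d with _ | d
      · exact Ideal.mem_sup_left (h' a ha
          (mem_of_mem_sup_span_singleton h₂ hg ha Nat.zero_lt_one haJ))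
      · obtain ⟨b, hb, c, hc, rfl⟩ := exists_eq_add_of_mem_sup_span_singleton h₂ hg ha haJ
        exact add_mem (Ideal.mem_sup_left (h' b hb.1 hb.2)) (Ideal.mem_sup_right
          (Ideal.mul_mem_right _ _ (Ideal.mem_span_singleton_self _)))

theorem finrank_degPart_sup_span_singleton_of_injAt (hfin : ∀ d, FiniteDimensional K (𝒜 d))
    {g : A} {i s : ℕ} (hJ : J.IsHomogeneous 𝒜) (hg : g ∈ 𝒜 1) (h : InjAt 𝒜 J g i s) :
    Module.finrank K (degPart 𝒜 (J ⊔ Ideal.span {g ^ s}) (i + s)) +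
      Module.finrank K (degPart 𝒜 J i) =
        Module.finrank K (𝒜 i) + Module.finrank K (degPart 𝒜 J (i + s)) := by
  have := hfin i
  have : FiniteDimensional K (colonPart 𝒜 J g i s) :=
    Submodule.finiteDimensional_of_le (inf_le_left : _ ≤ 𝒜 i)
  rw [← imagePart_eq_degPart hJ hg, ← finrank_colonPart_add_finrank_imagePart 𝒜 J i s hfin hg,
    add_comm]
  congr 1
  exact le_antisymm (Submodule.finrank_mono (degPart_le_colonPart 𝒜 J g i s))
    ((injAt_iff_finrank 𝒜 J g i s hfin).1 h)

theorem finrank_degPart_sup_span_singleton_of_surjAt (hfin : ∀ d, FiniteDimensional K (𝒜 d))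
    {g : A} {i s : ℕ} (hJ : J.IsHomogeneous 𝒜) (hg : g ∈ 𝒜 1) (h : SurjAt 𝒜 J g i s) :
    Module.finrank K (degPart 𝒜 (J ⊔ Ideal.span {g ^ s}) (i + s)) =
      Module.finrank K (𝒜 (i + s)) := by
  have := hfin (i + s)
  rw [← imagePart_eq_degPart hJ hg]
  exact le_antisymm (Submodule.finrank_mono (imagePart_le 𝒜 J i s hg))
    ((surjAt_iff_finrank 𝒜 J i s hfin hg).1 h)

theorem degPart_sup_span_singleton_zero {g : A} (hJ : J.IsHomogeneous 𝒜) (hg : g ∈ 𝒜 1) :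
    degPart 𝒜 (J ⊔ Ideal.span {g}) 0 = degPart 𝒜 J 0 :=
  le_antisymm
    (fun _ ha => ⟨ha.1, mem_of_mem_sup_span_singleton hJ hg ha.1 Nat.zero_lt_one ha.2⟩)
    fun _ ha => ⟨ha.1, Ideal.mem_sup_left ha.2⟩

/-- Dividing by a Lefschetz element replaces the Hilbert function `h` by `Δh`. -/
theorem SLPMod.hilbertFunction_sup_span_singleton (hfin : ∀ d, FiniteDimensional K (𝒜 d))
    {g : A} (hJ : J.IsHomogeneous 𝒜) (hg : g ∈ 𝒜 1) (h : SLPMod 𝒜 J g) :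
    hilbertFunction (quotientGrading 𝒜 (J ⊔ Ideal.span {g})) =
      diff (hilbertFunction (quotientGrading 𝒜 J)) := by
  funext d
  rcases d with _ | d
  · have h1 := hilbertFunction_add_finrank_degPart 𝒜 J hfin 0
    have h2 := hilbertFunction_add_finrank_degPart 𝒜 (J ⊔ Ideal.span {g}) hfin 0
    rw [degPart_sup_span_singleton_zero hJ hg] at h2
    simp only [diff, prev]
    omega
  · have h1 := hilbertFunction_add_finrank_degPart 𝒜 J hfin d
    have h2 := hilbertFunction_add_finrank_degPart 𝒜 J hfin (d + 1)
    have h3 := hilbertFunction_add_finrank_degPart 𝒜 (J ⊔ Ideal.span {g}) hfin (d + 1)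
    simp only [diff, prev]
    rcases h d 1 Nat.zero_lt_one with hi | hi
    · have h4 := finrank_degPart_sup_span_singleton_of_injAt hfin hJ hg hi
      rw [pow_one] at h4
      have h5 := hi.hilbertFunction_le hfin hg
      omega
    · have h4 := finrank_degPart_sup_span_singleton_of_surjAt hfin hJ hg hi
      rw [pow_one] at h4
      have h5 := hi.hilbertFunction_le hfin hg
      omega

end Homogeneous

/-! ### Openness of the Lefschetz property -/

section Perturbation

open Filter Polynomial

variable {K A : Type*} [Field K] [CommRing A] [Algebra K A]

/-- Every homogeneous element of `J 0` lies on a polynomial curve whose value at `t` is a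
homogeneous element of `J t`. -/
def LiftsAlong (𝒜 : ℕ → Submodule K A) (J : K → Ideal A) : Prop :=
  ∀ d, ∀ f ∈ 𝒜 d, f ∈ J 0 → ∃ P : A[X], P.eval 0 = f ∧
    ∀ t : K, P.eval (algebraMap K A t) ∈ 𝒜 d ∧ P.eval (algebraMap K A t) ∈ J t

variable {𝒜 : ℕ → Submodule K A}

/-- Semicontinuity: a basis of the fibre at `0` moves along polynomial curves, and its linear
independence is witnessed by a determinant that is a polynomial in `t` with value `1` at `t = 0`. -/
theorem eventually_finrank_degPart_le [Infinite K] (hfin : ∀ d, FiniteDimensional K (𝒜 d))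
    {J : K → Ideal A} (hL : LiftsAlong 𝒜 J) (d : ℕ) :
    ∀ᶠ t in cofinite, Module.finrank K (degPart 𝒜 (J 0) d) ≤
      Module.finrank K (degPart 𝒜 (J t) d) := by
  have := finiteDimensional_degPart 𝒜 (J 0) hfin d
  let b := Module.finBasis K (degPart 𝒜 (J 0) d)
  set r := Module.finrank K (degPart 𝒜 (J 0) d)
  obtain ⟨π, hπ⟩ := LinearMap.exists_leftInverse_of_injective
    ((degPart 𝒜 (J 0) d).subtype ∘ₗ b.equivFun.symm.toLinearMap)
    (LinearMap.ker_eq_bot.2 (Subtype.val_injective.comp b.equivFun.symm.injective))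
  have hπb : ∀ j, π (b j) = Pi.single j 1 := fun j => by
    have := LinearMap.congr_fun hπ (Pi.single j 1)
    simpa using this
  choose P hP0 hP using fun j => hL d (b j) (b j).2.1 (b j).2.2
  -- The curves have coefficients in `A`; applying the coordinates `π` coefficientwise gives a
  -- matrix over `K[X]`.
  let M : Matrix (Fin r) (Fin r) K[X] := Matrix.of fun j i =>
    (P j).sum fun n a => Polynomial.monomial n (π a i)
  have hM : ∀ t : K, M.map (Polynomial.eval t) =
      Matrix.of fun j i => π ((P j).eval (algebraMap K A t)) i := by
    intro t
    ext j i
    rw [Matrix.of_apply, Polynomial.eval_eq_sum, Polynomial.sum_def, map_sum, Finset.sum_apply,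
      Matrix.map_apply]
    simp only [M, Matrix.of_apply, Polynomial.sum_def, Polynomial.eval_finsetSum,
      Polynomial.eval_monomial]
    refine Finset.sum_congr rfl fun n _ => ?_
    rw [← map_pow, mul_comm (_ : A), ← Algebra.smul_def, map_smul, Pi.smul_apply, smul_eq_mul,
      mul_comm]
  have hdet : ∀ t : K, M.det.eval t =
      (Matrix.of fun j i => π ((P j).eval (algebraMap K A t)) i).det := by
    intro t
    rw [← hM t]
    exact RingHom.map_det (Polynomial.evalRingHom t) M
  have hne : M.det ≠ 0 := by
    intro h0
    have h1 := hdet 0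
    have : (Matrix.of fun j i => π ((P j).eval (algebraMap K A 0)) i) = 1 := by
      ext j i
      rw [Matrix.of_apply, map_zero, hP0, hπb, Matrix.one_apply, Pi.single_apply]
      simp [eq_comm]
    rw [this, h0] at h1
    simp at h1
  have hroots : ∀ᶠ t in cofinite, M.det.eval t ≠ 0 := by
    refine (Polynomial.finite_setOfPred_isRoot hne).subset fun t ht => ?_
    simpa using ht
  filter_upwards [hroots] with t ht
  rw [hdet t] at ht
  have hli : LinearIndependent K fun j => π ((P j).eval (algebraMap K A t)) :=
    Matrix.linearIndependent_rows_of_det_ne_zero ht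
  have hli' := LinearIndependent.of_comp π hli
  have := finiteDimensional_degPart 𝒜 (J t) hfin d
  have hli'' : LinearIndependent K fun j =>
      (⟨(P j).eval (algebraMap K A t), hP j t⟩ : degPart 𝒜 (J t) d) :=
    LinearIndependent.of_comp (degPart 𝒜 (J t) d).subtype hli'
  simpa using hli''.fintype_card_le_finrank

variable [GradedAlgebra 𝒜]

/-- An element `a + G(0) b` of the special fibre is lifted by lifting `a` and keeping `b` constant.
-/
theorem LiftsAlong.sup_span_singleton {J : K → Ideal A} (hL : LiftsAlong 𝒜 J)
    (hJ : (J 0).IsHomogeneous 𝒜) {s : ℕ} (G : A[X])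
    (hG : ∀ t : K, G.eval (algebraMap K A t) ∈ 𝒜 s) :
    LiftsAlong 𝒜 fun t => J t ⊔ Ideal.span {G.eval (algebraMap K A t)} := by
  intro d f hf hfJ
  simp only at hfJ
  rcases lt_or_ge d s with hd | hd
  · obtain ⟨P, h1, h2⟩ := hL d f hf (mem_of_mem_sup_span_singleton hJ (hG 0) hf hd hfJ)
    exact ⟨P, h1, fun t => ⟨(h2 t).1, Ideal.mem_sup_left (h2 t).2⟩⟩
  · obtain ⟨i, rfl⟩ := Nat.exists_eq_add_of_le' hd
    obtain ⟨a, ha, b, hb, rfl⟩ := exists_eq_add_of_mem_sup_span_singleton hJ (hG 0) hf hfJ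
    obtain ⟨P, h1, h2⟩ := hL _ a ha.1 ha.2
    refine ⟨P + G * Polynomial.C b, by simp [h1], fun t => ?_⟩
    rw [Polynomial.eval_add, Polynomial.eval_mul, Polynomial.eval_C]
    refine ⟨add_mem (h2 t).1 ?_, add_mem (Ideal.mem_sup_left (h2 t).2)
      (Ideal.mem_sup_right (Ideal.mul_mem_right _ _ (Ideal.mem_span_singleton_self _)))⟩
    rw [add_comm]
    exact SetLike.mul_mem_graded (hG t) hb

/-- Full rank means that `J + (G ^ s)` has the largest dimension in degree `i + s` that the
dimensions of `J` allow. These are constant for almost all `t`, so semicontinuity forces the maximum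
there too. -/
theorem eventually_injAt_or_surjAt [Infinite K] (hfin : ∀ d, FiniteDimensional K (𝒜 d))
    {J : K → Ideal A} (hJ : ∀ t, (J t).IsHomogeneous 𝒜) (hL : LiftsAlong 𝒜 J)
    (heq : ∀ d, ∀ᶠ t in cofinite, Module.finrank K (degPart 𝒜 (J t) d) =
      Module.finrank K (degPart 𝒜 (J 0) d))
    (G : A[X]) (hG : ∀ t : K, G.eval (algebraMap K A t) ∈ 𝒜 1) {i s : ℕ}
    (h : InjAt 𝒜 (J 0) (G.eval 0) i s ∨ SurjAt 𝒜 (J 0) (G.eval 0) i s) :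
    ∀ᶠ t in cofinite, Module.finrank K
        (degPart 𝒜 (J t ⊔ Ideal.span {G.eval (algebraMap K A t) ^ s}) (i + s)) =
          Module.finrank K (degPart 𝒜 (J 0 ⊔ Ideal.span {G.eval 0 ^ s}) (i + s)) ∧
      (InjAt 𝒜 (J t) (G.eval (algebraMap K A t)) i s ∨
        SurjAt 𝒜 (J t) (G.eval (algebraMap K A t)) i s) := by
  have hGs : ∀ t : K, (G ^ s).eval (algebraMap K A t) ∈ 𝒜 s := fun t => by
    simpa using SetLike.pow_mem_graded s (hG t)
  have hG0 : G.eval 0 ∈ 𝒜 1 := by simpa using hG 0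
  have hle := eventually_finrank_degPart_le hfin (hL.sup_span_singleton (hJ 0) (G ^ s) hGs) (i + s)
  filter_upwards [hle, heq i, heq (i + s)] with t hle h1 h2
  rw [Polynomial.eval_pow, Polynomial.eval_pow, map_zero] at hle
  have := hfin i
  have := hfin (i + s)
  have h3 := finrank_colonPart_add_finrank_imagePart 𝒜 (J t) i s hfin (hG t)
  rw [imagePart_eq_degPart (hJ t) (hG t)] at h3
  have : FiniteDimensional K (colonPart 𝒜 (J t) (G.eval (algebraMap K A t)) i s) :=
    Submodule.finiteDimensional_of_le (inf_le_left : _ ≤ 𝒜 i)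
  have h4 := Submodule.finrank_mono (degPart_le_colonPart 𝒜 (J t) (G.eval (algebraMap K A t)) i s)
  have h6 : Module.finrank K
      (degPart 𝒜 (J t ⊔ Ideal.span {G.eval (algebraMap K A t) ^ s}) (i + s)) ≤
        Module.finrank K (𝒜 (i + s)) := Submodule.finrank_mono inf_le_left
  rw [injAt_iff_finrank 𝒜 (J t) _ i s hfin, surjAt_iff_finrank 𝒜 (J t) i s hfin (hG t),
    imagePart_eq_degPart (hJ t) (hG t)]
  rcases h with h | h
  · have h5 := finrank_degPart_sup_span_singleton_of_injAt hfin (hJ 0) hG0 h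
    omega
  · have h5 := finrank_degPart_sup_span_singleton_of_surjAt hfin (hJ 0) hG0 h
    omega

theorem eventually_slpMod [Infinite K] (hfin : ∀ d, FiniteDimensional K (𝒜 d))
    {J : K → Ideal A} (hJ : ∀ t, (J t).IsHomogeneous 𝒜) (hL : LiftsAlong 𝒜 J)
    (heq : ∀ d, ∀ᶠ t in cofinite, Module.finrank K (degPart 𝒜 (J t) d) =
      Module.finrank K (degPart 𝒜 (J 0) d))
    {c : ℕ} (hc : ∀ t, ∀ d ≥ c, ∀ a ∈ 𝒜 d, a ∈ J t)
    (G : A[X]) (hG : ∀ t : K, G.eval (algebraMap K A t) ∈ 𝒜 1)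
    (h : SLPMod 𝒜 (J 0) (G.eval 0)) :
    ∀ᶠ t in cofinite, SLPMod 𝒜 (J t) (G.eval (algebraMap K A t)) := by
  have key : ∀ᶠ t in cofinite, ∀ i ∈ Finset.range c, ∀ s ∈ Finset.range c, 0 < s →
      (InjAt 𝒜 (J t) (G.eval (algebraMap K A t)) i s ∨
        SurjAt 𝒜 (J t) (G.eval (algebraMap K A t)) i s) := by
    rw [Filter.eventually_all_finset]
    intro i _
    rw [Filter.eventually_all_finset]
    intro s _
    rcases Nat.eq_zero_or_pos s with rfl | hs
    · simp
    · filter_upwards [eventually_injAt_or_surjAt hfin hJ hL heq G hG (h i s hs)] with t ht _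
      exact ht.2
  filter_upwards [key] with t ht i s hs
  -- Targets in degree at least `c` are zero, so finitely many pairs `(i, s)` suffice and the
  -- finitely many exceptional sets may be united.
  by_cases hi : i + s < c
  · exact ht i (Finset.mem_range.2 (by omega)) s (Finset.mem_range.2 (by omega)) hs
  · exact Or.inr fun b hb => ⟨0, zero_mem _, by simpa using hc t _ (not_lt.1 hi) b hb⟩

theorem eventually_finrank_degPart_sup_span_singleton_eq [Infinite K]
    (hfin : ∀ d, FiniteDimensional K (𝒜 d))
    {J : K → Ideal A} (hJ : ∀ t, (J t).IsHomogeneous 𝒜) (hL : LiftsAlong 𝒜 J)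
    (heq : ∀ d, ∀ᶠ t in cofinite, Module.finrank K (degPart 𝒜 (J t) d) =
      Module.finrank K (degPart 𝒜 (J 0) d))
    (G : A[X]) (hG : ∀ t : K, G.eval (algebraMap K A t) ∈ 𝒜 1)
    (h : SLPMod 𝒜 (J 0) (G.eval 0)) (d : ℕ) :
    ∀ᶠ t in cofinite, Module.finrank K
        (degPart 𝒜 (J t ⊔ Ideal.span {G.eval (algebraMap K A t)}) d) =
          Module.finrank K (degPart 𝒜 (J 0 ⊔ Ideal.span {G.eval (algebraMap K A 0)}) d) := by
  rcases d with _ | d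
  · filter_upwards [heq 0] with t ht
    rw [degPart_sup_span_singleton_zero (hJ t) (hG t),
      degPart_sup_span_singleton_zero (hJ 0) (hG 0), ht]
  · filter_upwards [eventually_injAt_or_surjAt hfin hJ hL heq G hG (h d 1 Nat.zero_lt_one)]
      with t ht
    have := ht.1
    rwa [pow_one, pow_one, ← map_zero (algebraMap K A)] at this

/-- The same linear forms serve for almost all `t`; only the ideal moves. Constancy of dimensions
passes to `J t + (g)` because `g` has full rank. -/
theorem eventually_kslpMod [Infinite K] (hfin : ∀ d, FiniteDimensional K (𝒜 d)) (k : ℕ)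
    {J : K → Ideal A} (hJ : ∀ t, (J t).IsHomogeneous 𝒜) (hL : LiftsAlong 𝒜 J)
    (heq : ∀ d, ∀ᶠ t in cofinite, Module.finrank K (degPart 𝒜 (J t) d) =
      Module.finrank K (degPart 𝒜 (J 0) d))
    {c : ℕ} (hc : ∀ t, ∀ d ≥ c, ∀ a ∈ 𝒜 d, a ∈ J t) (h : KSLPMod 𝒜 k (J 0)) :
    ∀ᶠ t in cofinite, KSLPMod 𝒜 k (J t) := by
  induction k generalizing J with
  | zero => exact Eventually.of_forall fun _ => trivial
  | succ k ih =>
    obtain ⟨g, hg, hs, hk⟩ := h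
    have hG : ∀ t : K, (Polynomial.C g).eval (algebraMap K A t) ∈ 𝒜 1 := by simpa using hg
    have hs' : SLPMod 𝒜 (J 0) ((Polynomial.C g).eval 0) := by simpa using hs
    have h1 := eventually_slpMod hfin hJ hL heq hc (Polynomial.C g) hG hs'
    have h2 := ih (fun t => isHomogeneous_sup_span_singleton (hJ t) (hG t))
      (hL.sup_span_singleton (hJ 0) _ hG)
      (eventually_finrank_degPart_sup_span_singleton_eq hfin hJ hL heq _ hG hs')
      (fun t d hd a ha => Ideal.mem_sup_left (hc t d hd a ha)) (by simpa using hk)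
    filter_upwards [h1, h2] with t h1 h2
    rw [Polynomial.eval_C] at h1 h2
    exact ⟨g, hg, h1, h2⟩

/-- The first linear element in the definition of the `k`-strong Lefschetz property may be
perturbed in any given direction. -/
theorem KSLPMod.exists_eventually [Infinite K] (hfin : ∀ d, FiniteDimensional K (𝒜 d)) {k : ℕ}
    {J : Ideal A} (hJ : J.IsHomogeneous 𝒜) {c : ℕ} (hc : ∀ d ≥ c, ∀ a ∈ 𝒜 d, a ∈ J)
    (h : KSLPMod 𝒜 (k + 1) J) {x : A} (hx : x ∈ 𝒜 1) :
    ∃ g ∈ 𝒜 1, ∀ᶠ t in (cofinite : Filter K), SLPMod 𝒜 J (g + t • x) ∧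
      KSLPMod 𝒜 k (J ⊔ Ideal.span {g + t • x}) := by
  obtain ⟨g, hg, hs, hk⟩ := h
  refine ⟨g, hg, ?_⟩
  let G : A[X] := Polynomial.C g + Polynomial.X * Polynomial.C x
  have hGe : ∀ t : K, G.eval (algebraMap K A t) = g + t • x := fun t => by
    rw [Algebra.smul_def, mul_comm]
    simp [G]
  have hG : ∀ t : K, G.eval (algebraMap K A t) ∈ 𝒜 1 := fun t => by
    rw [hGe]; exact add_mem hg (Submodule.smul_mem _ _ hx)
  have hL : LiftsAlong 𝒜 fun _ : K => J := fun d f hf hfJ =>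
    ⟨Polynomial.C f, by simp, fun t => by simpa using ⟨hf, hfJ⟩⟩
  have heq : ∀ d, ∀ᶠ _ in (cofinite : Filter K), Module.finrank K (degPart 𝒜 J d) =
      Module.finrank K (degPart 𝒜 J d) := fun d => Eventually.of_forall fun _ => rfl
  have hs' : SLPMod 𝒜 J (G.eval 0) := by simpa [G] using hs
  have h1 := eventually_slpMod hfin (fun _ : K => hJ) hL heq (fun _ => hc) G hG hs'
  have h2 := eventually_kslpMod hfin k (fun t => isHomogeneous_sup_span_singleton hJ (hG t))
    (hL.sup_span_singleton hJ G hG)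
    (eventually_finrank_degPart_sup_span_singleton_eq hfin (fun _ : K => hJ) hL heq G hG hs')
    (fun t d hd a ha => Ideal.mem_sup_left (hc d hd a ha)) (by simpa [G] using hk)
  filter_upwards [h1, h2] with t h1 h2
  rw [hGe] at h1 h2
  exact ⟨h1, h2⟩

end Perturbation

/-! ### The Lefschetz element `ℓ + y` -/

section FirstStep

theorem add_pow_succ_of_sq_eq_zero {R : Type*} [CommRing R] {x y : R} (hy : y ^ 2 = 0) (s : ℕ) :
    (x + y) ^ (s + 1) = x ^ (s + 1) + (s + 1) * (y * x ^ s) := by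
  induction s with
  | zero => simp
  | succ s ih =>
    rw [pow_succ, ih]
    push_cast
    linear_combination (s + 1) * x ^ s * hy

/-- A case distinction for a sequence without valleys that satisfies (C1) and (C2). -/
theorem fullRank_cases {h : ℕ → ℕ} (h1 : CondC1 h) (h2 : CondC2 h)
    (hv : ∀ a b c, a ≤ b → b ≤ c → h b < h a → h b < h c → False) (i s : ℕ) :
    (h (i + 1) ≤ h (i + 1 + s) ∧ h i ≤ h (i + (s + 2))) ∨
    (h (i + 1) ≤ h (i + 1 + (s + 1)) ∧ h i ≤ h (i + (s + 1))) ∨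
    (h (i + 1 + s) ≤ h (i + 1) ∧ h (i + (s + 2)) ≤ h i) ∨
    (h (i + 1 + (s + 1)) ≤ h (i + 1) ∧ h (i + (s + 1)) ≤ h i) := by
  rw [show i + 1 + (s + 1) = i + s + 1 + 1 by ring, show i + 1 + s = i + s + 1 by ring,
    show i + (s + 2) = i + s + 1 + 1 by ring, show i + (s + 1) = i + s + 1 by ring]
  by_contra hcon
  have c1 := h1 i
  have c2 := h2 (i + s + 1)
  have v1 : ¬ (h (i + s + 1) < h i ∧ h (i + s + 1) < h (i + s + 1 + 1)) := fun H =>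
    hv i (i + s + 1) (i + s + 1 + 1) (by omega) (by omega) H.1 H.2
  have v2 : ¬ (h (i + 1) < h i ∧ h (i + 1) < h (i + s + 1 + 1)) := fun H =>
    hv i (i + 1) (i + s + 1 + 1) (by omega) (by omega) H.1 H.2
  -- Apart from valleys, failure of all four alternatives leaves two patterns. Here two adjacent
  -- values lie strictly inside the ascent from `i` to `i + 1`, against (C1).
  by_cases hA : h i < h (i + s + 1) ∧ h i < h (i + s + 1 + 1) ∧ h (i + s + 1) < h (i + 1) ∧
      h (i + s + 1 + 1) < h (i + 1)
  · have := c1 (by omega) (show i + s + 1 ∈ {j | h i < h j ∧ h j < h (i + 1)} from ⟨hA.1, hA.2.2.1⟩)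
      (show i + s + 1 + 1 ∈ {j | h i < h j ∧ h j < h (i + 1)} from ⟨hA.2.1, hA.2.2.2⟩)
    omega
  -- The mirror pattern: `h i` and `h (i + 1)` lie strictly inside a descent, against (C2).
  by_cases hB : h (i + s + 1 + 1) < h i ∧ h i < h (i + s + 1) ∧ h (i + s + 1 + 1) < h (i + 1) ∧
      h (i + 1) < h (i + s + 1)
  · have := c2 (by omega)
      (show i ∈ {j | h (i + s + 1 + 1) < h j ∧ h j < h (i + s + 1)} from ⟨hB.1, hB.2.1⟩)
      (show i + 1 ∈ {j | h (i + s + 1 + 1) < h j ∧ h j < h (i + s + 1)} from ⟨hB.2.2.1, hB.2.2.2⟩)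
    omega
  omega

variable {K A B : Type*} [Field K] [CommRing A] [Algebra K A] [CommRing B] [Algebra K B]
variable {𝒜 : ℕ → Submodule K A} {I : Ideal A} {ι : A →ₐ[K] B} {J : Ideal B} {y : B}

/-- Comparison of the coefficients of `1` and `y`. Kernels are the case `c = d = 0`, images the
general one. -/
theorem mul_add_mem_iff (hy : y ^ 2 ∈ J)
    (hJ : ∀ p q, ι p + y * ι q ∈ J ↔ p ∈ I ∧ q ∈ I) (ℓ p q : A) (b : B) (hb : b - (ι p + y * ι q) ∈ J)
    (c d : A) (s : ℕ) :
    (ι c + y * ι d) - (ι ℓ + y) ^ (s + 1) * b ∈ J ↔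
      c - ℓ ^ (s + 1) * p ∈ I ∧ d - (ℓ ^ (s + 1) * q + (s + 1) * (ℓ ^ s * p)) ∈ I := by
  rw [← hJ, ← Ideal.Quotient.eq_zero_iff_mem, ← Ideal.Quotient.eq_zero_iff_mem]
  have hb' := Ideal.Quotient.eq_zero_iff_mem.2 hb
  have hy' : Ideal.Quotient.mk J y ^ 2 = 0 := by
    rw [← map_pow]; exact Ideal.Quotient.eq_zero_iff_mem.2 hy
  rw [map_sub, sub_eq_zero] at hb'
  simp only [map_sub, map_add, map_mul, map_pow, map_natCast, map_one, hb',
    add_pow_succ_of_sq_eq_zero hy']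
  refine iff_of_eq (congrArg (· = 0) ?_)
  linear_combination (-(s + 1) * Ideal.Quotient.mk J (ι ℓ) ^ s *
    Ideal.Quotient.mk J (ι q)) * hy'

variable {𝒞 : ℕ → Submodule K B}

/-- If `B / J` is `(A / I)[y] / (y ^ 2)` and the Hilbert function of `A / I` satisfies (C1) and
(C2), then `ℓ + y` is a Lefschetz element of `B / J` whenever `ℓ` is one of `A / I`. -/
theorem SLPMod.add_squareZero [CharZero K] [SetLike.GradedMonoid 𝒜]
    (hfin : ∀ d, FiniteDimensional K (𝒜 d)) (hy : y ^ 2 ∈ J)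
    (hJ : ∀ p q, ι p + y * ι q ∈ J ↔ p ∈ I ∧ q ∈ I)
    (hι : ∀ d, ∀ p ∈ 𝒜 d, ι p ∈ 𝒞 d) (hιy : ∀ d, ∀ p ∈ 𝒜 d, y * ι p ∈ 𝒞 (d + 1))
    (h0 : ∀ f ∈ 𝒞 0, ∃ p ∈ 𝒜 0, f - ι p ∈ J)
    (hsucc : ∀ d, ∀ f ∈ 𝒞 (d + 1), ∃ p ∈ 𝒜 (d + 1), ∃ q ∈ 𝒜 d, f - (ι p + y * ι q) ∈ J)
    {ℓ : A} (hℓ : ℓ ∈ 𝒜 1) (h : SLPMod 𝒜 I ℓ)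
    (h1 : CondC1 (hilbertFunction (quotientGrading 𝒜 I)))
    (h2 : CondC2 (hilbertFunction (quotientGrading 𝒜 I)))
    (hle : hilbertFunction (quotientGrading 𝒜 I) 0 ≤ 1) : SLPMod 𝒞 J (ι ℓ + y) := by
  intro i s hs
  obtain ⟨s, rfl⟩ := Nat.exists_eq_add_of_lt hs
  rw [zero_add]
  have hc : ((s : K) + 1) ≠ 0 := Nat.cast_add_one_ne_zero s
  set M : A := algebraMap K A ((s : K) + 1)⁻¹ with hM
  have hMs : ((s : A) + 1) * M = 1 := by
    rw [hM, show ((s : A) + 1) = algebraMap K A ((s : K) + 1) by simp, ← map_mul,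
      mul_inv_cancel₀ hc, map_one]
  have hcancel : ∀ a : A, ((s : A) + 1) * a ∈ I → a ∈ I := fun a ha => by
    have := I.mul_mem_left M ha
    rwa [← mul_assoc, mul_comm M, hMs, one_mul] at this
  -- reduction of membership statements to `A`
  have hinj : ∀ (a : B) (p q : A), a - (ι p + y * ι q) ∈ J →
      (ι ℓ + y) ^ (s + 1) * a ∈ J →
        ℓ ^ (s + 1) * p ∈ I ∧ ℓ ^ (s + 1) * q + (s + 1) * (ℓ ^ s * p) ∈ I := fun a p q ha hm => by
    have := (mul_add_mem_iff hy hJ ℓ p q a ha 0 0 s).1 (by simpa using hm)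
    simpa only [zero_sub, neg_mem_iff] using this
  have hback : ∀ (a : B) (p q : A), a - (ι p + y * ι q) ∈ J → p ∈ I → q ∈ I → a ∈ J :=
    fun a p q ha hp hq => by
      rw [← sub_add_cancel a (ι p + y * ι q)]
      exact add_mem ha ((hJ p q).2 ⟨hp, hq⟩)
  rcases i with _ | i
  -- Degree `0` has no `y`-part. Either `ℓ ^ s` is injective there and the `y`-coefficient detects
  -- `p`, or `h 0 = 1`, `h s = 0`, and the target vanishes because `h` has no valleys.
  · by_cases hs0 : hilbertFunction (quotientGrading 𝒜 I) 0 ≤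
        hilbertFunction (quotientGrading 𝒜 I) (0 + s)
    · left
      intro a ha hm
      obtain ⟨p, hp, hap⟩ := h0 a ha
      have hap' : a - (ι p + y * ι 0) ∈ J := by simpa using hap
      obtain ⟨-, h4⟩ := hinj a p 0 hap' hm
      rw [mul_zero, zero_add] at h4
      exact hback a p 0 hap' (h.injAt hfin hℓ hs0 p hp (hcancel _ h4)) I.zero_mem
    · right
      have hv : ¬ (hilbertFunction (quotientGrading 𝒜 I) (0 + s) <
          hilbertFunction (quotientGrading 𝒜 I) (0 + s + 1)) := fun hlt => h.not_valley hfin hℓ (Nat.zero_le (0 + s)) (Nat.le_add_right (0 + s) 1)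
        (lt_of_not_ge hs0) hlt
      intro b hb
      obtain ⟨p, hp, q, hq, hbpq⟩ := hsucc (0 + s) b hb
      exact ⟨0, zero_mem _, by
        simpa using hback b p q hbpq (mem_of_hilbertFunction_eq_zero hfin (by omega) hp)
          (mem_of_hilbertFunction_eq_zero hfin (by omega) hq)⟩
  · rcases fullRank_cases h1 h2 (fun a b c hab hbc => h.not_valley hfin hℓ hab hbc) i s with
      ⟨hq, hp⟩ | ⟨hq, hp⟩ | ⟨hq, hp⟩ | ⟨hq, hp⟩
    · left
      intro a ha hm
      obtain ⟨p, hp', q, hq', hapq⟩ := hsucc i a ha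
      obtain ⟨h3, h4⟩ := hinj a p q hapq hm
      -- Eliminating `p` from the two equations leaves `ℓ ^ (s + 2) * q`.
      have hqI : q ∈ I := h.injAt hfin hℓ hp q hq' (by
        have := sub_mem (I.mul_mem_left ℓ h4) (I.mul_mem_left (s + 1 : A) h3)
        convert this using 1; ring)
      have hpI : p ∈ I := h.injAt hfin hℓ hq p hp' (hcancel _ (by
        have := sub_mem h4 (I.mul_mem_left (ℓ ^ (s + 1)) hqI)
        convert this using 1; ring))
      exact hback a p q hapq hpI hqI
    · left
      intro a ha hm
      obtain ⟨p, hp', q, hq', hapq⟩ := hsucc i a ha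
      obtain ⟨h3, h4⟩ := hinj a p q hapq hm
      have hpI : p ∈ I := h.injAt hfin hℓ hq p hp' h3
      have hqI : q ∈ I := h.injAt hfin hℓ hp q hq' (by
        have := sub_mem h4 (I.mul_mem_left ((s + 1 : A) * ℓ ^ s) hpI)
        convert this using 1; ring)
      exact hback a p q hapq hpI hqI
    all_goals
      right
      intro b hb
      have hb2 : b ∈ 𝒞 (i + s + 1 + 1) := by
        rwa [show i + s + 1 + 1 = i + 1 + (s + 1) by ring]
      obtain ⟨c, hc', d, hd', hbcd⟩ := hsucc (i + s + 1) b hb2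
      have hfinish : ∀ p ∈ 𝒜 (i + 1), ∀ q ∈ 𝒜 i, c - ℓ ^ (s + 1) * p ∈ I →
          d - (ℓ ^ (s + 1) * q + (s + 1) * (ℓ ^ s * p)) ∈ I →
          ∃ a ∈ 𝒞 (i + 1), b - (ι ℓ + y) ^ (s + 1) * a ∈ J := fun p hp q hq hcp hdq =>
        ⟨ι p + y * ι q, add_mem (hι _ _ hp) (hιy _ _ hq), by
          have := add_mem hbcd ((mul_add_mem_iff hy hJ ℓ p q (ι p + y * ι q) (by simp) c d s).2 ⟨hcp, hdq⟩)
          convert this using 1; ring⟩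
    · have hs1 := h.surjAt hfin hℓ hq
      have hs2 := h.surjAt hfin hℓ hp
      have hcs : ∀ x : A, ∀ m, x ∈ 𝒜 m → ((s : A) + 1) * x ∈ 𝒜 m := fun x m hx => by
        rw [show ((s : A) + 1) = algebraMap K A ((s : K) + 1) by simp, ← Algebra.smul_def]
        exact Submodule.smul_mem _ _ hx
      -- The element `ℓ f₀` solves the first equation and `M e` corrects the second. Subtracting `M
      -- ℓ f` keeps the first equation intact, and the choice `q = f` absorbs its effect on the
      -- second.
      obtain ⟨f₀, hf₀, hcf⟩ := hs2 c (by rwa [show i + (s + 2) = i + s + 1 + 1 by ring])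
      obtain ⟨e, he, hde⟩ := hs1 (d - (s + 1) * (ℓ ^ (s + 1) * f₀)) (by
        rw [show i + 1 + s = i + s + 1 by ring]
        exact sub_mem hd' (hcs _ _ (pow_mul_mem 𝒜 hℓ (s + 1) hf₀)))
      obtain ⟨f, hf, hef⟩ := hs2 (ℓ ^ (s + 1) * e) (by
        rw [show i + (s + 2) = i + 1 + (s + 1) by ring]
        exact pow_mul_mem 𝒜 hℓ (s + 1) he)
      have hℓm : ∀ x ∈ 𝒜 i, ℓ * x ∈ 𝒜 (i + 1) := fun x hx => by
        simpa using pow_mul_mem 𝒜 hℓ 1 hx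
      refine hfinish (ℓ * f₀ + M * (e - ℓ * f)) (add_mem (hℓm _ hf₀) ?_) f hf ?_ ?_
      · rw [hM, ← Algebra.smul_def]
        exact Submodule.smul_mem _ _ (sub_mem he (hℓm _ hf))
      · have := sub_mem hcf (I.mul_mem_left M hef)
        convert this using 1; ring
      · convert hde using 1
        linear_combination (-ℓ ^ s * (e - ℓ * f)) * hMs
    · have hs1 := h.surjAt hfin hℓ hq
      have hs2 := h.surjAt hfin hℓ hp
      have hcs : ∀ x : A, ∀ m, x ∈ 𝒜 m → ((s : A) + 1) * x ∈ 𝒜 m := fun x m hx => by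
        rw [show ((s : A) + 1) = algebraMap K A ((s : K) + 1) by simp, ← Algebra.smul_def]
        exact Submodule.smul_mem _ _ hx
      obtain ⟨p, hp', hcp⟩ := hs1 c (by rwa [show i + 1 + (s + 1) = i + s + 1 + 1 by ring])
      obtain ⟨q, hq', hdq⟩ := hs2 (d - (s + 1) * (ℓ ^ s * p)) (by
        refine sub_mem (by rwa [show i + (s + 1) = i + s + 1 by ring]) (hcs _ _ ?_)
        rw [show i + (s + 1) = i + 1 + s by ring]
        exact pow_mul_mem 𝒜 hℓ s hp')
      refine hfinish p hp' q hq' hcp ?_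
      convert hdq using 1; ring

end FirstStep

/-! ### Polynomial rings and stable ideals -/

section PolynomialRing

open MvPolynomial

attribute [local instance] MvPolynomial.gradedAlgebra

variable {K : Type*} [Field K]

theorem finiteDimensional_homogeneousSubmodule (n d : ℕ) :
    FiniteDimensional K (homogeneousSubmodule (Fin n) K d) :=
  Module.Finite.iff_fg.2 (homogeneousSubmodule_fg (Fin n) K d)

theorem hilbertFunction_zero_le_one {n : ℕ} (I : Ideal (MvPolynomial (Fin n) K)) :
    hilbertFunction (quotientGrading (homogeneousSubmodule (Fin n) K) I) 0 ≤ 1 := by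
  have h : quotientGrading (homogeneousSubmodule (Fin n) K) I 0 ≤
      Submodule.span K {1} := by
    rintro _ ⟨f, hf, rfl⟩
    rw [totalDegree_eq_zero_iff_eq_C.1 ((totalDegree_zero_iff_isHomogeneous _).2 hf)]
    exact Submodule.mem_span_singleton.2 ⟨coeff 0 f, by
      rw [← Algebra.algebraMap_eq_smul_one]; rfl⟩
  exact (Submodule.finrank_mono h).trans ((finrank_span_le_card _).trans (by simp))

/-- A functional on `V / W` turns the sum into a polynomial in `t` with infinitely many zeros. -/
theorem forall_mem_of_sum_pow_smul_mem [Infinite K] {V : Type*} [AddCommGroup V] [Module K V]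
    (W : Submodule K V) (v : ℕ → V) (N : ℕ)
    (h : ∀ t : K, t ≠ 0 → ∑ j ∈ Finset.range N, t ^ j • v j ∈ W) : ∀ j < N, v j ∈ W := by
  intro j hj
  rw [← Submodule.Quotient.mk_eq_zero, ← Module.forall_dual_apply_eq_zero_iff K]
  intro φ
  let p : Polynomial K := ∑ j ∈ Finset.range N, Polynomial.monomial j (φ (W.mkQ (v j)))
  have hp : p = 0 := by
    refine Polynomial.eq_zero_of_infinite_isRoot p
      ((Set.finite_singleton (0 : K)).infinite_compl.mono fun t ht => ?_)
    have h1 : W.mkQ (∑ j ∈ Finset.range N, t ^ j • v j) = 0 :=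
      (Submodule.Quotient.mk_eq_zero W).2 (h t ht)
    have h2 := congrArg φ h1
    simp only [map_sum, map_smul, map_zero, smul_eq_mul] at h2
    change p.eval t = 0
    simp only [p, Polynomial.eval_finsetSum, Polynomial.eval_monomial]
    rw [← h2]
    exact Finset.sum_congr rfl fun _ _ => mul_comm _ _
  have := congrArg (fun q => Polynomial.coeff q j) hp
  simpa [p, Polynomial.finsetSum_coeff, Polynomial.coeff_monomial, hj] using this

/-- The algebra endomorphism `φ` is given by an invertible upper triangular matrix. -/
def IsTriangular {n : ℕ} (φ : MvPolynomial (Fin n) K →ₐ[K] MvPolynomial (Fin n) K) : Prop :=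
  ∀ j, ∃ a : K, a ≠ 0 ∧ ∃ u ∈ Submodule.span K (X '' Set.Iio j), φ (X j) = a • X j + u

/-- The ideal `I` is mapped into itself by all triangular substitutions. -/
def IsStable {n : ℕ} (I : Ideal (MvPolynomial (Fin n) K)) : Prop :=
  ∀ φ, IsTriangular φ → ∀ f ∈ I, φ f ∈ I

theorem exists_sum_smul_of_mem_span {n : ℕ} {j : Fin n} {u : MvPolynomial (Fin n) K}
    (hu : u ∈ Submodule.span K (X '' Set.Iio j)) :
    ∃ b : Fin n → K, (∀ i, j ≤ i → b i = 0) ∧ u = ∑ i, b i • X i := by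
  induction hu using Submodule.span_induction with
  | mem x hx =>
    obtain ⟨i, hi, rfl⟩ := hx
    refine ⟨Pi.single i 1, fun l hl => Pi.single_eq_of_ne (hi.trans_le hl).ne' _, ?_⟩
    simp [Pi.single_apply, ite_smul]
  | zero => exact ⟨0, by simp, by simp⟩
  | add x y _ _ hx hy =>
    obtain ⟨b, hb, rfl⟩ := hx
    obtain ⟨c, hc, rfl⟩ := hy
    exact ⟨b + c, fun i hi => by simp [hb i hi, hc i hi],
      by simp [add_smul, Finset.sum_add_distrib]⟩
  | smul a x _ hx =>
    obtain ⟨b, hb, rfl⟩ := hx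
    exact ⟨a • b, fun i hi => by simp [hb i hi], by simp [Finset.smul_sum, mul_smul]⟩

theorem IsBorelFixed.isStable {n : ℕ} {I : Ideal (MvPolynomial (Fin n) K)} (hI : IsBorelFixed I) :
    IsStable I := by
  intro φ hφ f hf
  choose a ha u hu hφX using hφ
  choose b hb hub using fun j => exists_sum_smul_of_mem_span (hu j)
  let M : Matrix (Fin n) (Fin n) K := Matrix.of fun i j => if i = j then a j else b j i
  have hM : M.IsUpperTriangular := by
    intro i j hij
    have hij : j < i := hij
    simp [M, hij.ne', hb j i hij.le]
  have hdet : M.det ≠ 0 := by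
    rw [Matrix.det_of_isUpperTriangular hM]
    simpa [M, Finset.prod_ne_zero_iff] using ha
  let g := Matrix.GeneralLinearGroup.mkOfDetNeZero M hdet
  have hg : linearSubst g = φ := by
    refine algHom_ext fun j => ?_
    rw [linearSubst, aeval_X, hφX, hub, Fintype.sum_eq_add_sum_compl j,
      Fintype.sum_eq_add_sum_compl j, hb j j le_rfl, zero_smul, zero_add]
    congr 1
    · simp [g, M, Matrix.GeneralLinearGroup.mkOfDetNeZero, smul_eq_C_mul]
    · refine Finset.sum_congr rfl fun i hi => ?_
      have : i ≠ j := by simpa using hi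
      simp [g, M, Matrix.GeneralLinearGroup.mkOfDetNeZero, smul_eq_C_mul, this]
  have h := hI g fun i j hij => hM hij
  rw [hg] at h
  rw [← h]
  exact Ideal.mem_map_of_mem _ hf

theorem aeval_smul_X_of_isHomogeneous {n d : ℕ} {f : MvPolynomial (Fin n) K}
    (hf : f.IsHomogeneous d) (t : K) : aeval (fun i => t • X i) f = t ^ d • f := by
  conv_rhs => rw [f.as_sum, Finset.smul_sum]
  rw [aeval_def, eval₂_eq]
  refine Finset.sum_congr rfl fun m hm => ?_
  rw [hf.degree_eq_sum_deg_support hm, monomial_eq, Finsupp.prod, smul_eq_C_mul]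
  simp only [smul_eq_C_mul, mul_pow, Finset.prod_mul_distrib, Finset.prod_pow_eq_pow_sum, map_pow,
    algebraMap_eq]
  ring

/-- Scaling all variables by `t` is triangular and multiplies the degree `j` component by `t ^ j`.
-/
theorem IsStable.isHomogeneous [Infinite K] {n : ℕ} {I : Ideal (MvPolynomial (Fin n) K)}
    (hI : IsStable I) : I.IsHomogeneous (homogeneousSubmodule (Fin n) K) := by
  intro i f hf
  have key : homogeneousComponent i f ∈ I := by
    rcases lt_or_ge f.totalDegree i with h | h
    · rw [homogeneousComponent_eq_zero _ _ h]
      exact I.zero_mem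
    · refine forall_mem_of_sum_pow_smul_mem (I.restrictScalars K)
        (fun j => homogeneousComponent j f) (f.totalDegree + 1) (fun t ht => ?_) i (by omega)
      have h1 := hI (aeval fun i => t • X i)
        (fun j => ⟨t, ht, 0, zero_mem _, by simp⟩) f hf
      rw [← sum_homogeneousComponent f, map_sum] at h1
      simp only [aeval_smul_X_of_isHomogeneous (homogeneousComponent_isHomogeneous _ f)] at h1
      exact h1
  have h : (DirectSum.decompose (homogeneousSubmodule (Fin n) K) f i : MvPolynomial (Fin n) K) =
      homogeneousComponent i f := decomposition.decompose'_apply f i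
  rwa [h]

theorem exists_forall_homogeneous_mem {n : ℕ} {I : Ideal (MvPolynomial (Fin n) K)}
    (hI : I.IsHomogeneous (homogeneousSubmodule (Fin n) K))
    (hA : IsArtinianRing (MvPolynomial (Fin n) K ⧸ I)) :
    ∃ c, ∀ d ≥ c, ∀ f ∈ homogeneousSubmodule (Fin n) K d, f ∈ I := by
  have hX : ∀ i : Fin n, ∃ N, (X i : MvPolynomial (Fin n) K) ^ N ∈ I := by
    intro i
    obtain ⟨N, b, hb⟩ := IsArtinian.exists_pow_succ_smul_dvd
      (Ideal.Quotient.mk I (X i : MvPolynomial (Fin n) K)) (1 : MvPolynomial (Fin n) K ⧸ I)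
    obtain ⟨b, rfl⟩ := Ideal.Quotient.mk_surjective b
    refine ⟨N, ?_⟩
    have h1 : X i ^ (N + 1) * b - X i ^ N ∈ I := by
      rw [← Ideal.Quotient.eq]
      simpa using hb
    -- The chain condition gives `x ^ N ≡ x ^ (N + 1) b`; the degree `N` component of the difference
    -- is `-x ^ N`.
    have h2 := hI N h1
    rw [DirectSum.decompose_sub, DirectSum.sub_apply, Submodule.coe_sub,
      DirectSum.decompose_of_mem_same _
        (show X i ^ N ∈ homogeneousSubmodule (Fin n) K N from isHomogeneous_X_pow i N),
      DirectSum.coe_decompose_mul_of_left_mem_of_not_le _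
        (show X i ^ (N + 1) ∈ homogeneousSubmodule (Fin n) K (N + 1) from isHomogeneous_X_pow i _)
        (by omega), zero_sub, neg_mem_iff] at h2
    exact h2
  choose N hN using hX
  refine ⟨∑ i, N i + 1, fun d hd f hf => ?_⟩
  rw [f.as_sum]
  refine Ideal.sum_mem _ fun m hm => ?_
  have hdeg := IsHomogeneous.degree_eq_sum_deg_support hf hm
  obtain ⟨i, hi⟩ : ∃ i, N i ≤ m i := by
    by_contra! hcon
    have h1 : ∑ i, m i ≤ ∑ i, N i := Finset.sum_le_sum fun i _ => (hcon i).le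
    have h2 := Finset.sum_le_sum_of_subset (f := fun i => m i) (Finset.subset_univ m.support)
    omega
  rw [monomial_eq]
  refine Ideal.mul_mem_left _ _ ?_
  rw [Finsupp.prod_fintype _ _ (by simp)]
  exact Ideal.mem_of_dvd _ ((pow_dvd_pow _ hi).trans (Finset.dvd_prod_of_mem _ (Finset.mem_univ i)))
    (hN i)

/-! ### Splitting off the last variable -/

section Embedding

variable {m : ℕ}

/-- The inclusion of `K[x_1, …, x_m]` into `K[x_1, …, x_{m+1}]`. -/
noncomputable def incl : MvPolynomial (Fin m) K →ₐ[K] MvPolynomial (Fin (m + 1)) K :=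
  rename Fin.castSucc

/-- The algebra morphism on `K[x_1, …, x_{m+1}]` that extends `φ` and sends `x_{m+1}` to `b`. -/
noncomputable def extendLast {B : Type*} [CommRing B] [Algebra K B]
    (φ : MvPolynomial (Fin m) K →ₐ[K] B) (b : B) : MvPolynomial (Fin (m + 1)) K →ₐ[K] B :=
  aeval (Fin.lastCases b fun i => φ (X i))

section

variable {B : Type*} [CommRing B] [Algebra K B] (φ : MvPolynomial (Fin m) K →ₐ[K] B) (b : B)

@[simp]
theorem incl_X (i : Fin m) : incl (X i : MvPolynomial (Fin m) K) = X i.castSucc := by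
  simp [incl]

@[simp]
theorem extendLast_X_last : extendLast φ b (X (Fin.last m)) = b := by
  simp [extendLast]

@[simp]
theorem extendLast_X_castSucc (i : Fin m) : extendLast φ b (X i.castSucc) = φ (X i) := by
  simp [extendLast]

theorem extendLast_comp_incl : (extendLast φ b).comp incl = φ :=
  algHom_ext fun i => by simp

@[simp]
theorem extendLast_incl (f : MvPolynomial (Fin m) K) : extendLast φ b (incl f) = φ f :=
  AlgHom.congr_fun (extendLast_comp_incl φ b) f

end

theorem algHom_ext_last {B : Type*} [Semiring B] [Algebra K B]
    {φ ψ : MvPolynomial (Fin (m + 1)) K →ₐ[K] B} (h : ∀ f, φ (incl f) = ψ (incl f))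
    (hl : φ (X (Fin.last m)) = ψ (X (Fin.last m))) : φ = ψ := by
  refine algHom_ext fun i => Fin.lastCases hl (fun i => ?_) i
  simpa using h (X i)

theorem incl_mem {d : ℕ} {f : MvPolynomial (Fin m) K} (hf : f ∈ homogeneousSubmodule (Fin m) K d) :
    incl f ∈ homogeneousSubmodule (Fin (m + 1)) K d :=
  IsHomogeneous.rename_isHomogeneous hf

theorem extendLast_id_mem {b f} {d : ℕ} (hb : b ∈ homogeneousSubmodule (Fin m) K 1)
    (hf : f ∈ homogeneousSubmodule (Fin (m + 1)) K d) :
    extendLast (AlgHom.id K _) b f ∈ homogeneousSubmodule (Fin m) K d := by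
  have := IsHomogeneous.aeval (n := 1) hf
    (Fin.lastCases b fun i => (X i : MvPolynomial (Fin m) K)) (fun i => by
      refine Fin.lastCases ?_ (fun i => ?_) i
      · simpa using hb
      · simpa using isHomogeneous_X K i)
  rwa [one_mul] at this

theorem map_extendLast_id {b} (hb : b ∈ homogeneousSubmodule (Fin m) K 1) (d : ℕ) :
    (homogeneousSubmodule (Fin (m + 1)) K d).map (extendLast (AlgHom.id K _) b).toLinearMap =
      homogeneousSubmodule (Fin m) K d := by
  refine le_antisymm ?_ fun f hf => ⟨incl f, incl_mem hf, by simp⟩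
  rintro _ ⟨f, hf, rfl⟩
  exact extendLast_id_mem hb hf

theorem extendLast_id_surjective (b : MvPolynomial (Fin m) K) :
    Function.Surjective (extendLast (AlgHom.id K _) b) :=
  fun f => ⟨incl f, by simp⟩

theorem sub_incl_extendLast_id_mem (b : MvPolynomial (Fin m) K)
    (f : MvPolynomial (Fin (m + 1)) K) :
    f - incl (extendLast (AlgHom.id K _) b f) ∈ Ideal.span {X (Fin.last m) - incl b} := by
  have h : (Ideal.Quotient.mkₐ K (Ideal.span {X (Fin.last m) - incl b})) =
      (Ideal.Quotient.mkₐ K (Ideal.span {X (Fin.last m) - incl b})).comp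
        (incl.comp (extendLast (AlgHom.id K _) b)) := by
    refine algHom_ext_last (fun f => by simp) ?_
    simpa using Ideal.Quotient.eq.2 (Ideal.mem_span_singleton_self (X (Fin.last m) - incl b))
  exact Ideal.Quotient.eq.1 (AlgHom.congr_fun h f)

theorem comap_extendLast_id (J : Ideal (MvPolynomial (Fin m) K)) (b : MvPolynomial (Fin m) K) :
    J.comap (extendLast (AlgHom.id K _) b) =
      J.map incl ⊔ Ideal.span {X (Fin.last m) - incl b} := by
  refine le_antisymm (fun f hf => ?_) (sup_le (Ideal.map_le_iff_le_comap.2 fun f hf => ?_) ?_)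
  · rw [← sub_add_cancel f (incl (extendLast (AlgHom.id K _) b f))]
    exact add_mem (Ideal.mem_sup_right (sub_incl_extendLast_id_mem b f))
      (Ideal.mem_sup_left (Ideal.mem_map_of_mem _ hf))
  · simpa using hf
  · rw [Ideal.span_singleton_le_iff_mem]
    simp

theorem exists_eq_incl {f : MvPolynomial (Fin (m + 1)) K}
    (hf : f ∈ homogeneousSubmodule (Fin (m + 1)) K 0) :
    ∃ p ∈ homogeneousSubmodule (Fin m) K 0, f = incl p := by
  have h0 : (0 : MvPolynomial (Fin m) K) ∈ homogeneousSubmodule (Fin m) K 1 := zero_mem _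
  refine ⟨_, extendLast_id_mem h0 hf, ?_⟩
  have h := sub_incl_extendLast_id_mem 0 f
  rw [map_zero, sub_zero] at h
  have := mem_of_mem_sup_span_singleton (Ideal.IsHomogeneous.bot _)
    (isHomogeneous_X K (Fin.last m)) (sub_mem hf (incl_mem (extendLast_id_mem h0 hf)))
    Nat.zero_lt_one (Ideal.mem_sup_right h)
  exact sub_eq_zero.1 this

theorem exists_eq_incl_add {d : ℕ} {f : MvPolynomial (Fin (m + 1)) K}
    (hf : f ∈ homogeneousSubmodule (Fin (m + 1)) K (d + 1)) :
    ∃ p ∈ homogeneousSubmodule (Fin m) K (d + 1),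
      ∃ r ∈ homogeneousSubmodule (Fin (m + 1)) K d, f = incl p + X (Fin.last m) * r := by
  have h0 : (0 : MvPolynomial (Fin m) K) ∈ homogeneousSubmodule (Fin m) K 1 := zero_mem _
  refine ⟨_, extendLast_id_mem h0 hf, ?_⟩
  have h := sub_incl_extendLast_id_mem 0 f
  rw [map_zero, sub_zero] at h
  obtain ⟨a, ha, r, hr, har⟩ := exists_eq_add_of_mem_sup_span_singleton
    (Ideal.IsHomogeneous.bot _) (isHomogeneous_X K (Fin.last m))
    (sub_mem hf (incl_mem (extendLast_id_mem h0 hf))) (Ideal.mem_sup_right h)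
  have ha0 : a = 0 := ha.2
  exact ⟨r, hr, by rw [ha0, zero_add] at har; rw [← har]; ring⟩

/-- Evaluation of a polynomial with coefficients in `K[x_1, …, x_m]` at `x_{m+1}`. -/
noncomputable def evalLast : Polynomial (MvPolynomial (Fin m) K) →+* MvPolynomial (Fin (m + 1)) K :=
  Polynomial.eval₂RingHom incl.toRingHom (X (Fin.last m))

theorem evalLast_apply (P : Polynomial (MvPolynomial (Fin m) K)) :
    evalLast P = ∑ j ∈ Finset.range (P.natDegree + 1), incl (P.coeff j) * X (Fin.last m) ^ j := by
  rw [evalLast, Polynomial.coe_eval₂RingHom, Polynomial.eval₂_eq_sum_range]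
  rfl

theorem evalLast_surjective :
    Function.Surjective (evalLast : Polynomial (MvPolynomial (Fin m) K) →+* _) := by
  intro f
  induction f using MvPolynomial.induction_on with
  | C a => exact ⟨Polynomial.C (C a), by simp [evalLast, incl]⟩
  | add p q hp hq =>
    obtain ⟨P, rfl⟩ := hp
    obtain ⟨Q, rfl⟩ := hq
    exact ⟨P + Q, map_add _ _ _⟩
  | mul_X p i hp =>
    obtain ⟨P, rfl⟩ := hp
    refine Fin.lastCases ⟨P * Polynomial.X, by simp [evalLast]⟩ (fun i => ?_) i
    exact ⟨P * Polynomial.C (X i), by simp [evalLast]⟩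

/-- Scaling the last variable alone is triangular, so a stable ideal is graded by the degree in that
variable. -/
theorem incl_coeff_mul_X_pow_mem [Infinite K] {I : Ideal (MvPolynomial (Fin (m + 1)) K)}
    (hI : IsStable I) {P : Polynomial (MvPolynomial (Fin m) K)} (hP : evalLast P ∈ I) (j : ℕ) :
    incl (P.coeff j) * X (Fin.last m) ^ j ∈ I := by
  rcases lt_or_ge P.natDegree j with h | h
  · rw [Polynomial.coeff_eq_zero_of_natDegree_lt h, map_zero, zero_mul]
    exact I.zero_mem
  refine forall_mem_of_sum_pow_smul_mem (I.restrictScalars K)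
    (fun j => incl (P.coeff j) * X (Fin.last m) ^ j) (P.natDegree + 1) (fun t ht => ?_) j (by omega)
  have h1 := hI (extendLast incl (t • X (Fin.last m))) (fun j => by
    refine Fin.lastCases ⟨t, ht, 0, zero_mem _, by simp⟩
      (fun j => ⟨1, one_ne_zero, 0, zero_mem _, by simp⟩) j) _ hP
  rw [evalLast_apply, map_sum] at h1
  convert h1 using 2 with j
  simp [smul_pow]

/-- The parts of degree `0` and `1` in the last variable of an element of a stable ideal. -/
theorem IsStable.mem_of_add_mem [Infinite K] {I : Ideal (MvPolynomial (Fin (m + 1)) K)}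
    (hI : IsStable I) {p q : MvPolynomial (Fin m) K} {r : MvPolynomial (Fin (m + 1)) K}
    (h : incl p + X (Fin.last m) * (incl q + X (Fin.last m) * r) ∈ I) :
    incl p ∈ I ∧ X (Fin.last m) * incl q ∈ I := by
  obtain ⟨P, rfl⟩ := evalLast_surjective r
  have hP : evalLast (Polynomial.C p + Polynomial.X * (Polynomial.C q + Polynomial.X * P)) ∈ I := by
    convert h using 1
    simp [evalLast]
  have h0 := incl_coeff_mul_X_pow_mem hI hP 0
  have h1 := incl_coeff_mul_X_pow_mem hI hP 1
  simp only [Polynomial.coeff_add, Polynomial.coeff_C_zero, Polynomial.mul_coeff_zero,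
    Polynomial.coeff_X_zero, zero_mul, add_zero, pow_zero, mul_one] at h0
  have hc : (Polynomial.C p + Polynomial.X * (Polynomial.C q + Polynomial.X * P)).coeff 1 = q := by
    simp [Polynomial.coeff_C, Polynomial.coeff_X_mul _ 0]
  rw [hc, pow_one, mul_comm] at h1
  exact ⟨h0, h1⟩

theorem IsStable.comap_incl {I : Ideal (MvPolynomial (Fin (m + 1)) K)} (hI : IsStable I) :
    IsStable (I.comap incl) := by
  intro φ hφ f hf
  have h := hI (extendLast (incl.comp φ) (X (Fin.last m))) (fun j => by
    refine Fin.lastCases ⟨1, one_ne_zero, 0, zero_mem _, by simp⟩ (fun j => ?_) j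
    obtain ⟨a, ha, u, hu, h⟩ := hφ j
    refine ⟨a, ha, incl u, ?_, by simp [h]⟩
    have h2 := Submodule.mem_map_of_mem (f := incl.toLinearMap) hu
    rw [Submodule.map_span, ← Set.image_comp] at h2
    refine Submodule.span_mono ?_ h2
    rintro _ ⟨i, hi, rfl⟩
    exact ⟨i.castSucc, Fin.castSucc_lt_castSucc_iff.2 hi, by simp⟩) (incl f) hf
  simpa using h

/-- This is the isomorphism `R'/I' ≅ R/(I, x)`: the part of an element of `I` free of `x` lies in
`I` again. -/
theorem IsStable.comap_extendLast_zero [Infinite K] {I : Ideal (MvPolynomial (Fin (m + 1)) K)}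
    (hI : IsStable I) : (I.comap incl).comap (extendLast (AlgHom.id K _) 0) =
      I ⊔ Ideal.span {X (Fin.last m)} := by
  rw [comap_extendLast_id, map_zero, sub_zero]
  refine le_antisymm (sup_le_sup_right Ideal.map_comap_le _) (sup_le (fun f hf => ?_) le_sup_right)
  obtain ⟨P, rfl⟩ := evalLast_surjective f
  have h0 := incl_coeff_mul_X_pow_mem hI hf 0
  rw [← P.divX_mul_X_add, map_add, map_mul]
  refine add_mem (Ideal.mem_sup_right (Ideal.mul_mem_left _ _ ?_))
    (Ideal.mem_sup_left ?_)
  · simp [evalLast]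
  · have := Ideal.mem_map_of_mem (incl (m := m) (K := K))
      (show P.coeff 0 ∈ I.comap incl by simpa using h0)
    simpa [evalLast] using this

end Embedding

end PolynomialRing

/-! ### The last variable as Lefschetz element, and the induction -/

section LastVariable

open MvPolynomial

attribute [local instance] MvPolynomial.gradedAlgebra

variable {K : Type*} [Field K] {m : ℕ}

theorem isHomogeneous_map_incl {I : Ideal (MvPolynomial (Fin m) K)}
    (hI : I.IsHomogeneous (homogeneousSubmodule (Fin m) K)) :
    (I.map incl).IsHomogeneous (homogeneousSubmodule (Fin (m + 1)) K) := by
  obtain ⟨S, hS⟩ := (Ideal.IsHomogeneous.iff_exists _ I).1 hI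
  rw [hS, Ideal.map_span]
  refine Ideal.homogeneous_span _ _ ?_
  rintro _ ⟨_, ⟨⟨f, d, hf⟩, -, rfl⟩, rfl⟩
  exact ⟨d, incl_mem hf⟩

theorem incl_mem_span_Iio {p : MvPolynomial (Fin m) K} (hp : p ∈ homogeneousSubmodule (Fin m) K 1) :
    incl p ∈ Submodule.span K (X '' Set.Iio (Fin.last m)) := by
  rw [homogeneousSubmodule_one_eq_span_X] at hp
  have h := Submodule.mem_map_of_mem (f := incl.toLinearMap) hp
  rw [Submodule.map_span, ← Set.range_comp] at h
  refine Submodule.span_mono ?_ h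
  rintro _ ⟨i, rfl⟩
  exact ⟨i.castSucc, Fin.castSucc_lt_last i, by simp⟩

/-- The substitution `x_{m+1} ↦ b x_{m+1} + p` that fixes the other variables. -/
noncomputable def lastSubst (b : K) (p : MvPolynomial (Fin m) K) :
    MvPolynomial (Fin (m + 1)) K →ₐ[K] MvPolynomial (Fin (m + 1)) K :=
  extendLast incl (b • X (Fin.last m) + incl p)

theorem isTriangular_lastSubst {b : K} (hb : b ≠ 0) {p : MvPolynomial (Fin m) K}
    (hp : p ∈ homogeneousSubmodule (Fin m) K 1) : IsTriangular (lastSubst b p) := fun j =>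
  Fin.lastCases ⟨b, hb, incl p, incl_mem_span_Iio hp, by simp [lastSubst]⟩
    (fun j => ⟨1, one_ne_zero, 0, zero_mem _, by simp [lastSubst]⟩) j

theorem lastSubst_lastSubst {b c : K} {p q : MvPolynomial (Fin m) K} (h : c * b = 1)
    (hq : q + c • p = 0) (f : MvPolynomial (Fin (m + 1)) K) :
    lastSubst b p (lastSubst c q f) = f := by
  have : (lastSubst b p).comp (lastSubst c q) = AlgHom.id K _ := by
    refine algHom_ext_last (fun f => by simp [lastSubst]) ?_
    have h1 := congrArg incl hq
    simp only [map_add, map_smul, map_zero] at h1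
    simp [lastSubst, smul_smul, h, add_assoc, add_comm (c • incl p), h1]
  exact AlgHom.congr_fun this f

theorem lastSubst_mem {b : K} {p : MvPolynomial (Fin m) K}
    (hp : p ∈ homogeneousSubmodule (Fin m) K 1) {d : ℕ} {f : MvPolynomial (Fin (m + 1)) K}
    (hf : f ∈ homogeneousSubmodule (Fin (m + 1)) K d) :
    lastSubst b p f ∈ homogeneousSubmodule (Fin (m + 1)) K d := by
  have := IsHomogeneous.aeval (n := 1) hf (Fin.lastCases (b • X (Fin.last m) + incl p)
    fun i => incl (X i : MvPolynomial (Fin m) K)) (fun i => by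
      refine Fin.lastCases ?_ (fun i => ?_) i
      · simpa using add_mem (Submodule.smul_mem _ b (isHomogeneous_X K (Fin.last m))) (incl_mem hp)
      · simpa using isHomogeneous_X K i.castSucc)
  rwa [one_mul] at this

/-- For a stable ideal the last variable may serve as the first linear element in the definition
of the `k`-strong Lefschetz property. -/
theorem IsStable.slpMod_last [Infinite K] {I : Ideal (MvPolynomial (Fin (m + 1)) K)}
    (hI : IsStable I) {c k : ℕ}
    (hc : ∀ d ≥ c, ∀ f ∈ homogeneousSubmodule (Fin (m + 1)) K d, f ∈ I)
    (h : KSLPMod (homogeneousSubmodule (Fin (m + 1)) K) (k + 1) I) :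
    SLPMod (homogeneousSubmodule (Fin (m + 1)) K) I (X (Fin.last m)) ∧
      KSLPMod (homogeneousSubmodule (Fin (m + 1)) K) k (I ⊔ Ideal.span {X (Fin.last m)}) := by
  obtain ⟨g, hg, hev⟩ := h.exists_eventually (finiteDimensional_homogeneousSubmodule (m + 1))
    hI.isHomogeneous hc (isHomogeneous_X K (Fin.last m))
  obtain ⟨p, hp, r, hr, rfl⟩ := exists_eq_incl_add (d := 0) hg
  obtain ⟨a, rfl⟩ : ∃ a : K, r = C a :=
    ⟨_, totalDegree_eq_zero_iff_eq_C.1 ((totalDegree_zero_iff_isHomogeneous _).2 hr)⟩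
  have hne : ∀ᶠ t in Filter.cofinite, t ≠ -a := (Set.finite_singleton (-a)).compl_mem_cofinite
  obtain ⟨t, ⟨h1, h2⟩, ht⟩ := (hev.and hne).exists
  -- The perturbed form is `p + (a + t) x`, the image of `x` under the invertible substitution
  -- `lastSubst (a + t) p`.
  have hb : a + t ≠ 0 := fun h0 => ht (eq_neg_of_add_eq_zero_right h0)
  have hp' : -((a + t)⁻¹ • p) ∈ homogeneousSubmodule (Fin m) K 1 :=
    neg_mem (Submodule.smul_mem _ _ hp)
  have hinv : ∀ f, lastSubst (a + t) p (lastSubst (a + t)⁻¹ (-((a + t)⁻¹ • p)) f) = f :=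
    lastSubst_lastSubst (inv_mul_cancel₀ hb) (by simp)
  have hinv' : ∀ f, lastSubst (a + t)⁻¹ (-((a + t)⁻¹ • p)) (lastSubst (a + t) p f) = f :=
    lastSubst_lastSubst (mul_inv_cancel₀ hb) (by simp [smul_smul, mul_inv_cancel₀ hb])
  have hmap : ∀ d, (homogeneousSubmodule (Fin (m + 1)) K d).map
      (lastSubst (a + t) p).toLinearMap = homogeneousSubmodule (Fin (m + 1)) K d := by
    refine fun d => le_antisymm ?_ fun f hf => ⟨_, lastSubst_mem hp' hf, hinv f⟩
    rintro _ ⟨f, hf, rfl⟩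
    exact lastSubst_mem hp hf
  have hcomap : I.comap (lastSubst (a + t) p) = I := by
    refine le_antisymm (fun f hf => ?_) (hI _ (isTriangular_lastSubst hb hp))
    rw [← hinv' f]
    exact hI _ (isTriangular_lastSubst (inv_ne_zero hb) hp') _ hf
  have hX : lastSubst (a + t) p (X (Fin.last m)) =
      incl p + X (Fin.last m) * C a + t • X (Fin.last m) := by
    simp only [lastSubst, extendLast_X_last, smul_eq_C_mul, map_add]
    ring
  rw [← hX] at h1 h2
  refine ⟨?_, ?_⟩
  · rw [← hcomap]
    exact (slpMod_comap_iff _ hmap I _).2 h1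
  · rw [← hcomap, ← comap_sup_span_singleton _ fun f => ⟨_, hinv f⟩]
    exact (kslpMod_comap_iff _ (fun f => ⟨_, hinv f⟩) hmap k _).2 h2

theorem incl_add_mul_incl_mem_iff (I : Ideal (MvPolynomial (Fin m) K))
    (p q : MvPolynomial (Fin m) K) :
    incl p + X (Fin.last m) * incl q ∈ I.map incl ⊔ Ideal.span {X (Fin.last m) ^ 2} ↔
      p ∈ I ∧ q ∈ I := by
  constructor
  · intro h
    -- Sending the last variable to `ε` in the dual numbers over `R/I` reads off `p` and `q` modulo
    -- `I`.
    let δ := extendLast (B := DualNumber (MvPolynomial (Fin m) K ⧸ I))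
      ((TrivSqZeroExt.inlAlgHom K _ _).comp (Ideal.Quotient.mkₐ K I)) DualNumber.eps
    have hle : I.map incl ⊔ Ideal.span {X (Fin.last m) ^ 2} ≤ RingHom.ker δ := by
      refine sup_le (Ideal.map_le_iff_le_comap.2 fun f hf => ?_) ?_
      · rw [Ideal.mem_comap, RingHom.mem_ker]
        simp [δ, Ideal.Quotient.eq_zero_iff_mem.2 hf]
      · rw [Ideal.span_singleton_le_iff_mem, RingHom.mem_ker]
        simp [δ, pow_two]
    have h1 : δ (incl p + X (Fin.last m) * incl q) = 0 := hle h
    have h2 := congrArg TrivSqZeroExt.fst h1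
    have h3 := congrArg TrivSqZeroExt.snd h1
    simp [δ] at h2 h3
    exact ⟨Ideal.Quotient.eq_zero_iff_mem.1 h2, Ideal.Quotient.eq_zero_iff_mem.1 h3⟩
  · rintro ⟨hp, hq⟩
    exact Ideal.mem_sup_left (add_mem (Ideal.mem_map_of_mem _ hp)
      (Ideal.mul_mem_left _ _ (Ideal.mem_map_of_mem _ hq)))

/-- The first two coefficients of a homogeneous polynomial with respect to the last variable. -/
theorem exists_sub_mem_span_sq {d : ℕ} {f : MvPolynomial (Fin (m + 1)) K}
    (hf : f ∈ homogeneousSubmodule (Fin (m + 1)) K (d + 1)) :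
    ∃ p ∈ homogeneousSubmodule (Fin m) K (d + 1), ∃ q ∈ homogeneousSubmodule (Fin m) K d,
      ∃ r, f = incl p + X (Fin.last m) * (incl q + X (Fin.last m) * r) := by
  obtain ⟨p, hp, r, hr, rfl⟩ := exists_eq_incl_add hf
  rcases d with _ | d
  · obtain ⟨q, hq, rfl⟩ := exists_eq_incl hr
    exact ⟨p, hp, q, hq, 0, by simp⟩
  · obtain ⟨q, hq, r, -, rfl⟩ := exists_eq_incl_add hr
    exact ⟨p, hp, q, hq, r, rfl⟩

/-- The case `k = 1`: the element `ℓ + y` of `(R / I)[y] / (y ^ 2)` is Lefschetz. -/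
theorem SLPMod.incl_add_X_last [CharZero K] {I : Ideal (MvPolynomial (Fin m) K)}
    {ℓ : MvPolynomial (Fin m) K} (hℓ : ℓ ∈ homogeneousSubmodule (Fin m) K 1)
    (h : SLPMod (homogeneousSubmodule (Fin m) K) I ℓ)
    (h1 : CondC1 (hilbertFunction (quotientGrading (homogeneousSubmodule (Fin m) K) I)))
    (h2 : CondC2 (hilbertFunction (quotientGrading (homogeneousSubmodule (Fin m) K) I))) :
    SLPMod (homogeneousSubmodule (Fin (m + 1)) K)
      (I.map incl ⊔ Ideal.span {X (Fin.last m) ^ 2}) (incl ℓ + X (Fin.last m)) := by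
  refine h.add_squareZero (finiteDimensional_homogeneousSubmodule m)
    (Ideal.mem_sup_right (Ideal.mem_span_singleton_self _)) (incl_add_mul_incl_mem_iff I)
    (fun d p hp => incl_mem hp) (fun d p hp => ?_) (fun f hf => ?_) (fun d f hf => ?_) hℓ h1 h2
    (hilbertFunction_zero_le_one I)
  · rw [add_comm d 1]
    exact (isHomogeneous_X K (Fin.last m)).mul (incl_mem hp)
  · obtain ⟨p, hp, rfl⟩ := exists_eq_incl hf
    exact ⟨p, hp, by simp⟩
  · obtain ⟨p, hp, q, hq, r, rfl⟩ := exists_sub_mem_span_sq hf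
    refine ⟨p, hp, q, hq, Ideal.mem_sup_right (Ideal.mem_span_singleton'.2 ⟨r, by ring⟩)⟩

/-- Without valleys the pattern `h e < h (e + 2) < h (e + 1)` makes `e + 1` the only maximum, with
the larger neighbour on the right, which (C3) excludes. -/
theorem condC3_contradiction {h : ℕ → ℕ} (h3 : CondC3 h)
    (hv : ∀ a b c, a ≤ b → b ≤ c → h b < h a → h b < h c → False) {e : ℕ}
    (he1 : h e < h (e + 2)) (he2 : h (e + 2) < h (e + 1)) : False := by
  have key : ∀ j, h (e + 1) ≤ h j → j = e + 1 := by
    intro j hj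
    by_contra hne
    rcases lt_or_gt_of_ne hne with hlt | hlt
    · have : ¬ h e < h j := fun H => hv j e (e + 2) (by omega) (by omega) H he1
      omega
    · have : ¬ h (e + 2) < h j := fun H => hv (e + 1) (e + 2) j (by omega) (by omega) he2 H
      omega
  rcases h3 with ⟨i, j, hij, hi, hj⟩ | ⟨i, hi, -, hle⟩
  · exact hij ((key i (hi _)).trans (key j (hj _)).symm)
  · obtain rfl := key i (hi _)
    simp only [prev] at hle
    exact absurd hle (not_le.2 he1)

/-- In every degree `R / (I, x ^ 2)` either vanishes or agrees with `(R' / I')[x] / (x ^ 2)`,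
where `x` is the last variable and `I'` is the contraction of `I` to the other variables. -/
theorem IsStable.eq_or_forall_mem [Infinite K] {I : Ideal (MvPolynomial (Fin (m + 1)) K)}
    (hI : IsStable I)
    (hx : SLPMod (homogeneousSubmodule (Fin (m + 1)) K) I (X (Fin.last m)))
    (h3 : CondC3 (hilbertFunction (quotientGrading (homogeneousSubmodule (Fin (m + 1)) K) I)))
    (d : ℕ) :
    (∀ a ∈ homogeneousSubmodule (Fin (m + 1)) K d, a ∈ I ⊔ Ideal.span {X (Fin.last m) ^ 2}) ∨
    ∀ a ∈ homogeneousSubmodule (Fin (m + 1)) K d, a ∈ I ⊔ Ideal.span {X (Fin.last m) ^ 2} →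
      a ∈ (I.comap incl).map incl ⊔ Ideal.span {X (Fin.last m) ^ 2} := by
  have hfin := finiteDimensional_homogeneousSubmodule (K := K) (m + 1)
  have hX : X (Fin.last m) ∈ homogeneousSubmodule (Fin (m + 1)) K 1 := isHomogeneous_X K _
  have hX2 : X (Fin.last m) ^ 2 ∈ homogeneousSubmodule (Fin (m + 1)) K 2 :=
    isHomogeneous_X_pow _ 2
  rcases d with _ | e
  · right
    intro a ha haI
    obtain ⟨p, hp, rfl⟩ := exists_eq_incl ha
    have := mem_of_mem_sup_span_singleton hI.isHomogeneous hX2 ha (by omega) haI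
    exact Ideal.mem_sup_left (Ideal.mem_map_of_mem _ this)
  by_cases hle : hilbertFunction (quotientGrading (homogeneousSubmodule (Fin (m + 1)) K) I) e ≤
      hilbertFunction (quotientGrading (homogeneousSubmodule (Fin (m + 1)) K) I) (e + 1)
  · right
    have hinj := hx.injAt hfin hX hle
    -- Stability puts `p` and `x q` in `I`; injectivity of `x` in degree `e` then puts `q` in `I`.
    have key : ∀ b ∈ homogeneousSubmodule (Fin (m + 1)) K (e + 1), b ∈ I →
        b ∈ (I.comap incl).map incl ⊔ Ideal.span {X (Fin.last m) ^ 2} := by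
      intro b hb hbI
      obtain ⟨p, hp, q, hq, r, rfl⟩ := exists_sub_mem_span_sq hb
      obtain ⟨hpI, hqI⟩ := hI.mem_of_add_mem hbI
      have hqI' := hinj _ (incl_mem hq) (by rwa [pow_one])
      rw [mul_add, ← add_assoc]
      refine add_mem ((incl_add_mul_incl_mem_iff _ p q).2 ⟨hpI, hqI'⟩)
        (Ideal.mem_sup_right (Ideal.mem_span_singleton'.2 ⟨r, by ring⟩))
    intro a ha haI
    rcases e with _ | e
    · exact key a ha (mem_of_mem_sup_span_singleton hI.isHomogeneous hX2 ha (by omega) haI)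
    · obtain ⟨b, hb, c, -, rfl⟩ := exists_eq_add_of_mem_sup_span_singleton hI.isHomogeneous hX2
        (i := e) ha haI
      exact add_mem (key b hb.1 hb.2) (Ideal.mem_sup_right
        (Ideal.mul_mem_right _ _ (Ideal.mem_span_singleton_self _)))
  · left
    intro a ha
    rcases e with _ | e
    · have h01 := hilbertFunction_zero_le_one I
      exact Ideal.mem_sup_left (mem_of_hilbertFunction_eq_zero hfin (by omega) ha)
    -- By (C3) a descent from `e + 1` to `e + 2` forces `h (e + 2) ≤ h e`, so `x ^ 2` maps onto
    -- degree `e + 2`.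
    · have hle2 := not_lt.1 fun hlt => condC3_contradiction h3
        (fun a b c hab hbc => hx.not_valley hfin hX hab hbc) (e := e) hlt (not_le.1 hle)
      obtain ⟨c, -, hac⟩ := hx.surjAt hfin hX hle2 a ha
      rw [← sub_add_cancel a (X (Fin.last m) ^ 2 * c)]
      exact add_mem (Ideal.mem_sup_left hac) (Ideal.mem_sup_right
        (Ideal.mul_mem_right _ _ (Ideal.mem_span_singleton_self _)))

theorem kslpMod_of_forall_pos_mem {A : Type*} [CommRing A] [Algebra K A] {𝒜 : ℕ → Submodule K A}
    (k : ℕ) {J : Ideal A} (h : ∀ d, ∀ a ∈ 𝒜 (d + 1), a ∈ J) : KSLPMod 𝒜 k J := by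
  induction k generalizing J with
  | zero => trivial
  | succ k ih =>
    refine ⟨0, zero_mem _, fun i s hs => Or.inr fun b hb => ⟨0, zero_mem _, ?_⟩,
      ih fun d a ha => Ideal.mem_sup_left (h d a ha)⟩
    obtain ⟨s, rfl⟩ := Nat.exists_eq_add_of_lt hs
    simpa using h _ b (by simpa [← add_assoc] using hb)

theorem eq_zero_of_mem_homogeneousSubmodule_zero {d : ℕ} {f : MvPolynomial (Fin 0) K}
    (hf : f ∈ homogeneousSubmodule (Fin 0) K (d + 1)) : f = 0 := by
  by_contra hne
  have := IsHomogeneous.inj_right (isHomogeneous_of_isEmpty _ _ f) hf hne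
  omega

/-- The lemma for polynomial rings: adjoining a variable with square zero preserves the
`k`-strong Lefschetz property. -/
theorem kslpMod_adjoin_squareZero [CharZero K] (k : ℕ) {n : ℕ}
    {I : Ideal (MvPolynomial (Fin n) K)} (hI : IsStable I) {c : ℕ}
    (hc : ∀ d ≥ c, ∀ f ∈ homogeneousSubmodule (Fin n) K d, f ∈ I)
    (h : KSLPMod (homogeneousSubmodule (Fin n) K) k I)
    (hC12 : ∀ s : ℕ, s + 1 ≤ k →
      CondC1 (diff^[s] (hilbertFunction (quotientGrading (homogeneousSubmodule (Fin n) K) I))) ∧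
        CondC2 (diff^[s] (hilbertFunction (quotientGrading (homogeneousSubmodule (Fin n) K) I))))
    (hC3 : ∀ s : ℕ, s + 2 ≤ k →
      CondC3 (diff^[s] (hilbertFunction (quotientGrading (homogeneousSubmodule (Fin n) K) I)))) :
    KSLPMod (homogeneousSubmodule (Fin (n + 1)) K) k
      (I.map incl ⊔ Ideal.span {X (Fin.last n) ^ 2}) := by
  induction k generalizing n with
  | zero => trivial
  | succ k ih =>
    obtain ⟨h1, h2⟩ := hC12 0 (by omega)
    have hXn : X (Fin.last n) ∈ homogeneousSubmodule (Fin (n + 1)) K 1 := isHomogeneous_X K _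
    rcases n with _ | m
    -- With no variables there is no `x`; the form `0` is Lefschetz, and dividing by `y` kills all
    -- positive degrees.
    · have hzero : SLPMod (homogeneousSubmodule (Fin 0) K) I 0 := fun i s hs => Or.inr fun b hb => by
        obtain ⟨s, rfl⟩ := Nat.exists_eq_add_of_lt hs
        rw [zero_add, ← add_assoc] at hb
        exact ⟨0, zero_mem _, by simp [eq_zero_of_mem_homogeneousSubmodule_zero hb]⟩
      refine ⟨_, add_mem (incl_mem (zero_mem _)) hXn,
        hzero.incl_add_X_last (zero_mem _) h1 h2, kslpMod_of_forall_pos_mem k fun d a ha => ?_⟩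
      obtain ⟨p, hp, r, -, rfl⟩ := exists_eq_incl_add ha
      rw [eq_zero_of_mem_homogeneousSubmodule_zero hp, map_zero, zero_add (X (Fin.last 0) * r), zero_add (X (Fin.last 0))]
      exact Ideal.mem_sup_right (Ideal.mul_mem_right _ _ (Ideal.mem_span_singleton_self _))
    · obtain ⟨hx, hk⟩ := hI.slpMod_last hc h
      have hX : X (Fin.last m) ∈ homogeneousSubmodule (Fin (m + 1)) K 1 := isHomogeneous_X K _
      have h0 : (0 : MvPolynomial (Fin m) K) ∈ homogeneousSubmodule (Fin m) K 1 := zero_mem _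
      refine ⟨_, add_mem (incl_mem hX) hXn, hx.incl_add_X_last hX h1 h2, ?_⟩
      rcases k with _ | k
      · trivial
      have hhilb : hilbertFunction
          (quotientGrading (homogeneousSubmodule (Fin m) K) (I.comap incl)) =
            diff (hilbertFunction (quotientGrading (homogeneousSubmodule (Fin (m + 1)) K) I)) := by
        rw [← hilbertFunction_comap _ (map_extendLast_id h0), hI.comap_extendLast_zero]
        exact hx.hilbertFunction_sup_span_singleton
          (finiteDimensional_homogeneousSubmodule (m + 1)) hI.isHomogeneous hX
      rw [← hI.comap_extendLast_zero, kslpMod_comap_iff _ (extendLast_id_surjective 0)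
        (map_extendLast_id h0)] at hk
      -- The square-zero variable that the induction hypothesis adjoins to `R'` is `x` itself.
      have hrec := ih hI.comap_incl (fun d hd f hf => hc d hd _ (incl_mem hf)) hk
        (fun s hs => by
          rw [hhilb, ← Function.iterate_succ_apply]
          exact hC12 (s + 1) (by omega))
        (fun s hs => by
          rw [hhilb, ← Function.iterate_succ_apply]
          exact hC3 (s + 1) (by omega))
      have hX2 : X (Fin.last m) ^ 2 ∈ homogeneousSubmodule (Fin (m + 1)) K 2 :=
        isHomogeneous_X_pow _ 2
      have hhom : ((I.comap incl).map incl : Ideal (MvPolynomial (Fin (m + 1)) K)).IsHomogeneous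
          (homogeneousSubmodule (Fin (m + 1)) K) :=
        isHomogeneous_map_incl hI.comap_incl.isHomogeneous
      have htrunc := hrec.of_le _ (isHomogeneous_sup_span_singleton hhom hX2)
        (isHomogeneous_sup_span_singleton hI.isHomogeneous hX2)
        (sup_le_sup_right Ideal.map_comap_le _) (hI.eq_or_forall_mem hx (hC3 0 (by omega)))
      have hθ := (kslpMod_comap_iff _ (extendLast_id_surjective (-X (Fin.last m)))
        (map_extendLast_id (neg_mem hX)) _ _).2 htrunc
      convert hθ using 1
      rw [comap_extendLast_id, map_neg, sub_neg_eq_add, add_comm (incl _), Ideal.map_sup,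
        Ideal.map_span, Set.image_singleton, sup_assoc, sup_assoc]
      congr 1
      -- Modulo `y + x` the squares agree, as `y² - x² = (y - x)(y + x)`.
      refine le_antisymm (sup_le ?_ le_sup_right) (sup_le ?_ le_sup_right)
      · rw [Ideal.span_singleton_le_iff_mem]
        have := Ideal.mem_span_singleton_self (incl (X (Fin.last m)) ^ 2 :
          MvPolynomial (Fin (m + 1 + 1)) K)
        have h5 := add_mem
          (Ideal.mem_sup_left (T := Ideal.span {X (Fin.last (m + 1)) + incl (X (Fin.last m))}) this)
          (Ideal.mem_sup_right (S := Ideal.span {incl (X (Fin.last m)) ^ 2})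
            (Ideal.mul_mem_left _ (X (Fin.last (m + 1)) - incl (X (Fin.last m)))
              (Ideal.mem_span_singleton_self (X (Fin.last (m + 1)) + incl (X (Fin.last m))))))
        rw [map_pow]
        convert h5 using 1; ring
      · rw [Ideal.span_singleton_le_iff_mem]
        have := Ideal.mem_span_singleton_self (X (Fin.last (m + 1)) ^ 2 :
          MvPolynomial (Fin (m + 1 + 1)) K)
        have h5 := sub_mem
          (Ideal.mem_sup_left (T := Ideal.span {X (Fin.last (m + 1)) + incl (X (Fin.last m))}) this)
          (Ideal.mem_sup_right (S := Ideal.span {X (Fin.last (m + 1)) ^ 2})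
            (Ideal.mul_mem_left _ (X (Fin.last (m + 1)) - incl (X (Fin.last m)))
              (Ideal.mem_span_singleton_self (X (Fin.last (m + 1)) + incl (X (Fin.last m))))))
        rw [map_pow]
        convert h5 using 1; ring

end LastVariable

/-! ### The tensor product as a quotient of a polynomial ring -/

section TensorProduct

open MvPolynomial

attribute [local instance] MvPolynomial.gradedAlgebra

variable {K A B : Type*} [Field K] {n : ℕ} [CommRing A] [Algebra K A] [CommRing B] [Algebra K B]
variable (π : MvPolynomial (Fin n) K →ₐ[K] A) (ρ : Polynomial K →ₐ[K] B)

/-- The morphism from the polynomial ring in one more variable `y` to `A ⊗ B` that is `π` on the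
old variables and sends `y` to `1 ⊗ ρ(X)`. -/
noncomputable def toTensor : MvPolynomial (Fin (n + 1)) K →ₐ[K] A ⊗[K] B :=
  extendLast (Algebra.TensorProduct.includeLeft.comp π) (1 ⊗ₜ ρ Polynomial.X)

theorem toTensor_incl (p : MvPolynomial (Fin n) K) : toTensor π ρ (incl p) = π p ⊗ₜ 1 := by
  simp [toTensor]

theorem toTensor_X_last : toTensor π ρ (X (Fin.last n)) = 1 ⊗ₜ ρ Polynomial.X := by
  simp [toTensor]

theorem toTensor_X_last_sq (hρ : ρ (Polynomial.X ^ 2) = 0) :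
    toTensor π ρ (X (Fin.last n) ^ 2) = 0 := by
  rw [map_pow, toTensor_X_last, Algebra.TensorProduct.tmul_pow, ← map_pow, hρ,
    TensorProduct.tmul_zero]

theorem toTensor_aeval_X_last (P : Polynomial K) :
    toTensor π ρ (Polynomial.aeval (X (Fin.last n)) P) = 1 ⊗ₜ ρ P := by
  have h : ((toTensor π ρ).comp (Polynomial.aeval (X (Fin.last n)))) =
      (Algebra.TensorProduct.includeRight : B →ₐ[K] A ⊗[K] B).comp ρ := by
    refine Polynomial.algHom_ext ?_
    simp [toTensor_X_last]
  exact AlgHom.congr_fun h P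

theorem toTensor_incl_mul_aeval (p : MvPolynomial (Fin n) K) (P : Polynomial K) :
    toTensor π ρ (incl p * Polynomial.aeval (X (Fin.last n)) P) = π p ⊗ₜ ρ P := by
  rw [map_mul, toTensor_incl, toTensor_aeval_X_last, Algebra.TensorProduct.tmul_mul_tmul, mul_one,
    one_mul]

variable {π ρ}

theorem toTensor_surjective (hπ : Function.Surjective π) (hρ : Function.Surjective ρ) :
    Function.Surjective (toTensor π ρ) := by
  intro x
  induction x using TensorProduct.induction_on with
  | zero => exact ⟨0, map_zero _⟩
  | tmul a b =>
    obtain ⟨p, rfl⟩ := hπ a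
    obtain ⟨P, rfl⟩ := hρ b
    exact ⟨_, toTensor_incl_mul_aeval π ρ p P⟩
  | add x y hx hy =>
    obtain ⟨f, rfl⟩ := hx
    obtain ⟨g, rfl⟩ := hy
    exact ⟨f + g, map_add _ _ _⟩

/-- The quotient map modulo `J` factors through the tensor product, because `A` and `B` both map to
that quotient; hence the kernel is no larger than `J`. -/
theorem comap_toTensor_bot (hπ : Function.Surjective π) (hρ : Function.Surjective ρ)
    {I : Ideal (MvPolynomial (Fin n) K)} (hI : RingHom.ker π = I)
    (hker : RingHom.ker ρ = Ideal.span {Polynomial.X ^ 2}) :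
    (⊥ : Ideal (A ⊗[K] B)).comap (toTensor π ρ) =
      I.map incl ⊔ Ideal.span {X (Fin.last n) ^ 2} := by
  set J := I.map incl ⊔ Ideal.span {X (Fin.last n) ^ 2}
  have hX : ρ (Polynomial.X ^ 2) = 0 := by
    rw [← RingHom.mem_ker, hker]
    exact Ideal.mem_span_singleton_self _
  refine le_antisymm (fun f hf => ?_) (sup_le (Ideal.map_le_iff_le_comap.2 fun p hp => ?_) ?_)
  · let ψ₁ : A →ₐ[K] (MvPolynomial (Fin (n + 1)) K ⧸ J) :=
      AlgHom.liftOfSurjective π hπ ((Ideal.Quotient.mkₐ K J).comp incl) fun p hp =>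
        Ideal.Quotient.eq_zero_iff_mem.2
          (Ideal.mem_sup_left (Ideal.mem_map_of_mem _ (hI ▸ hp : p ∈ I)))
    let ψ₂ : B →ₐ[K] (MvPolynomial (Fin (n + 1)) K ⧸ J) :=
      AlgHom.liftOfSurjective ρ hρ ((Ideal.Quotient.mkₐ K J).comp
        (Polynomial.aeval (X (Fin.last n)))) fun P hP => by
          replace hP : P ∈ Ideal.span {Polynomial.X ^ 2} := hker ▸ hP
          obtain ⟨Q, rfl⟩ := Ideal.mem_span_singleton'.1 hP
          refine Ideal.Quotient.eq_zero_iff_mem.2 (Ideal.mem_sup_right ?_)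
          rw [RingHom.coe_coe, map_mul, map_pow, Polynomial.aeval_X]
          exact Ideal.mul_mem_left _ _ (Ideal.mem_span_singleton_self _)
    have h : (Algebra.TensorProduct.productMap ψ₁ ψ₂).comp (toTensor π ρ) =
        Ideal.Quotient.mkₐ K J := by
      refine algHom_ext_last (fun p => ?_) ?_
      · rw [AlgHom.comp_apply, toTensor_incl, Algebra.TensorProduct.productMap_apply_tmul, map_one,
          mul_one]
        exact AlgHom.liftOfSurjective_apply _ _ _ _ _
      · rw [AlgHom.comp_apply, toTensor_X_last, Algebra.TensorProduct.productMap_apply_tmul,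
          map_one, one_mul]
        refine (AlgHom.liftOfSurjective_apply _ _ _ _ _).trans ?_
        rw [AlgHom.comp_apply, Polynomial.aeval_X]
    have hf0 : toTensor π ρ f = 0 := hf
    have h1 := AlgHom.congr_fun h f
    rw [AlgHom.comp_apply, hf0, map_zero] at h1
    exact Ideal.Quotient.eq_zero_iff_mem.1 h1.symm
  · rw [← hI] at hp
    change toTensor π ρ (incl p) = 0
    rw [toTensor_incl, (RingHom.mem_ker).1 hp, TensorProduct.zero_tmul]
  · rw [Ideal.span_singleton_le_iff_mem]
    exact toTensor_X_last_sq π ρ hX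

theorem tmul_mem_tensorGrading {𝒜 : ℕ → Submodule K A} {ℬ : ℕ → Submodule K B} {i j d : ℕ} {a : A}
    {b : B} (ha : a ∈ 𝒜 i) (hb : b ∈ ℬ j) (hd : i + j = d) :
    a ⊗ₜ[K] b ∈ tensorGrading 𝒜 ℬ d :=
  Submodule.mem_iSup_of_mem (i, j) (Submodule.mem_iSup_of_mem hd
    (Submodule.apply_mem_map₂ (TensorProduct.mk K A B) ha hb))

theorem toTensor_incl_add (hρ : ρ (Polynomial.X ^ 2) = 0) (p q : MvPolynomial (Fin n) K)
    (r : MvPolynomial (Fin (n + 1)) K) :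
    toTensor π ρ (incl p + X (Fin.last n) * (incl q + X (Fin.last n) * r)) =
      π p ⊗ₜ 1 + π q ⊗ₜ ρ Polynomial.X := by
  have h : toTensor π ρ (X (Fin.last n) ^ 2 * r) = 0 := by
    rw [map_mul, toTensor_X_last_sq π ρ hρ, zero_mul]
  have h2 : toTensor π ρ (X (Fin.last n) * incl q) = π q ⊗ₜ ρ Polynomial.X := by
    rw [map_mul, toTensor_incl, toTensor_X_last, Algebra.TensorProduct.tmul_mul_tmul, mul_one,
      one_mul]
  rw [show incl p + X (Fin.last n) * (incl q + X (Fin.last n) * r) =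
    incl p + X (Fin.last n) * incl q + X (Fin.last n) ^ 2 * r by ring, map_add, map_add, h, h2,
    toTensor_incl, add_zero]

theorem map_toTensor (hρ : ρ (Polynomial.X ^ 2) = 0) {𝒜 : ℕ → Submodule K A}
    {ℬ : ℕ → Submodule K B}
    (h𝒜 : ∀ i, (homogeneousSubmodule (Fin n) K i).map π.toLinearMap = 𝒜 i)
    (hℬ : ∀ j, (Submodule.span K {(Polynomial.X ^ j : Polynomial K)}).map ρ.toLinearMap = ℬ j)
    (d : ℕ) :
    (homogeneousSubmodule (Fin (n + 1)) K d).map (toTensor π ρ).toLinearMap =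
      tensorGrading 𝒜 ℬ d := by
  have hX : ∀ j, ρ (Polynomial.X ^ j) ∈ ℬ j := fun j => by
    rw [← hℬ]
    exact Submodule.mem_map_of_mem (f := ρ.toLinearMap) (Submodule.mem_span_singleton_self _)
  have hπ : ∀ {i p}, p ∈ homogeneousSubmodule (Fin n) K i → π p ∈ 𝒜 i := fun {i p} hp => by
    rw [← h𝒜]
    exact Submodule.mem_map_of_mem (f := π.toLinearMap) hp
  have h0 := hX 0
  have h1 := hX 1
  rw [pow_zero, map_one] at h0
  rw [pow_one] at h1
  refine le_antisymm ?_ (iSup_le fun ij => iSup_le fun hij => Submodule.map₂_le.2 ?_)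
  · rintro _ ⟨f, hf, rfl⟩
    change toTensor π ρ f ∈ _
    rcases d with _ | d
    · obtain ⟨p, hp, rfl⟩ := exists_eq_incl hf
      rw [toTensor_incl]
      exact tmul_mem_tensorGrading (hπ hp) h0 rfl
    · obtain ⟨p, hp, q, hq, r, rfl⟩ := exists_sub_mem_span_sq hf
      rw [toTensor_incl_add hρ]
      exact add_mem (tmul_mem_tensorGrading (hπ hp) h0 rfl)
        (tmul_mem_tensorGrading (hπ hq) h1 rfl)
  · intro a ha b hb
    rw [← h𝒜] at ha
    rw [← hℬ] at hb
    obtain ⟨p, hp, rfl⟩ := ha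
    obtain ⟨P, hP, rfl⟩ := hb
    obtain ⟨a, rfl⟩ := Submodule.mem_span_singleton.1 hP
    refine ⟨_, ?_, toTensor_incl_mul_aeval π ρ p _⟩
    rw [map_smul, map_pow, Polynomial.aeval_X, ← hij]
    exact IsHomogeneous.mul (incl_mem hp)
      (Submodule.smul_mem (homogeneousSubmodule (Fin (n + 1)) K ij.2) a (isHomogeneous_X_pow _ _))

theorem comap_mk_bot (J : Ideal A) :
    (⊥ : Ideal (A ⧸ J)).comap (Ideal.Quotient.mkₐ K J) = J := by
  ext a
  simp [Ideal.Quotient.eq_zero_iff_mem]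

end TensorProduct

end KSLP

theorem mainTheorem5 {K : Type*} [Field K] [CharZero K] (n k : ℕ) (hk : 0 < k)
    (I : Ideal (MvPolynomial (Fin n) K)) (hI : KSLP.IsBorelFixed I)
    (hArt : IsArtinianRing (MvPolynomial (Fin n) K ⧸ I))
    (hA : KSLP.HasKSLP (KSLP.polyQuotGrading I) k)
    (hC12 : ∀ s : ℕ, s + 1 ≤ k →
      KSLP.CondC1 (KSLP.diff^[s] (KSLP.hilbertFunction (KSLP.polyQuotGrading I))) ∧
        KSLP.CondC2 (KSLP.diff^[s] (KSLP.hilbertFunction (KSLP.polyQuotGrading I))))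
    (hC3 : ∀ s : ℕ, s + 2 ≤ k →
      KSLP.CondC3 (KSLP.diff^[s] (KSLP.hilbertFunction (KSLP.polyQuotGrading I)))) :
    KSLP.HasKSLP (KSLP.tensorGrading (KSLP.polyQuotGrading I) (KSLP.truncYGrading K)) k := by
  have hS := hI.isStable
  obtain ⟨c, hc⟩ := KSLP.exists_forall_homogeneous_mem hS.isHomogeneous hArt
  have hA' := (KSLP.kslpMod_comap_iff (Ideal.Quotient.mkₐ K I)
    (Ideal.Quotient.mkₐ_surjective K I) (fun _ => rfl) k ⊥).2
      ((KSLP.hasKSLP_iff_kslpMod k).1 hA)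
  rw [KSLP.comap_mk_bot] at hA'
  have hρ := Ideal.Quotient.mkₐ_surjective K (Ideal.span {(Polynomial.X ^ 2 : Polynomial K)})
  have hker := Ideal.Quotient.mkₐ_ker K (Ideal.span {(Polynomial.X ^ 2 : Polynomial K)})
  have hX : Ideal.Quotient.mkₐ K (Ideal.span {(Polynomial.X ^ 2 : Polynomial K)})
      (Polynomial.X ^ 2) = 0 :=
    Ideal.Quotient.eq_zero_iff_mem.2 (Ideal.mem_span_singleton_self _)
  refine (KSLP.hasKSLP_iff_kslpMod k).2 ((KSLP.kslpMod_comap_iff _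
    (KSLP.toTensor_surjective (Ideal.Quotient.mkₐ_surjective K I) hρ)
    (KSLP.map_toTensor hX (fun _ => rfl) fun _ => rfl) k ⊥).1 ?_)
  rw [KSLP.comap_toTensor_bot (Ideal.Quotient.mkₐ_surjective K I) hρ (Ideal.Quotient.mkₐ_ker K I)
    hker]
  exact KSLP.kslpMod_adjoin_squareZero k hS hc hA' hC12 hC3
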